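/- **Setting.** Let $M$ be a smooth 3-manifold, $\varphi\colon M\to\mathbb R^4$ a smooth immersion and $\xi\colon M\to\mathbb R^4$ a smooth transversal field such that $D\xi$ is tangential. The Gauss and Weingarten formulas $D_XY=\nabla_XY+h(X,Y)\xi$, $D_X\xi=-SX$ define the induced connection $\nabla$, the affine metric $h$ and the shape operator $S$. Assume that $h$ is nondegenerate and that $\xi$ is (up to sign) the affine (Blaschke) normal, i.e. $\det(\varphi_*X_1,\varphi_*X_2,\varphi_*X_3,\xi)^2=|\det(h(X_i,X_j))|$ for all tangent vectors $X_1,X_2,X_3$ at a point. Let $\hat\nabla$ be the Levi-Civita connection of $h$, $\hat R$ its curvature tensor, $\widehat{\mathrm{Ric}}(X,Y)=\mathrm{trace}\{Z\mapsto\hat R(Z,X)Y\}$, $\hat\kappa=\frac16\sum_{i,j}h^{ij}\widehat{\mathrm{Ric}}_{ij}$ the normalized scalar curvature, $K(X,Y)=\nabla_XY-\hat\nabla_XY$ the difference tensor and $J=\frac16h(K,K)$ the Pick invariant. Then $M$ is an *indefinite affine hypersphere* if $h$ is indefinite and $S=H\,\mathrm{Id}$ for a constant $H\in\mathbb R$.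 For $p\in M$ let $SO(T_pM,h)$ be the group of linear isometries of $(T_pM,h)$ of determinant $1$. A *traceless cubic form* on $T_pM$ is given by a bilinear map $C\colon T_pM\times T_pM\to T_pM$ such that $h(C(X,Y),Z)$ is totally symmetric and $\mathrm{trace}\,C(X,\cdot)=0$ for all $X$; its stabilizer consists of the $L\in SO(T_pM,h)$ with $C(LX,LY)=L\,C(X,Y)$ for all $X,Y$. The hypersurface *admits a pointwise $\mathbb R$-symmetry* if for every $p\in M$ there is a subgroup $G_p\subset SO(T_pM,h)$ that is isomorphic to the additive group $\mathbb R$, that is the stabilizer of some traceless cubic form on $T_pM$, and whose elements $L$ all satisfy $K(LX,LY)=L\,K(X,Y)$ and $SL=LS$ at $p$. (In particular this holds if the stabilizer of $K$ itself at every point is isomorphic to $\mathbb R$.) **Theorem.** Let $M$ be a 3-dimensional indefinite affine hypersphere, with $S=H\,\mathrm{Id}$, that admits a pointwise $\mathbb R$-symmetry. Then $h$ has constant sectional curvature equal to $H$ (on all nondegenerate tangent planes), $\hat\kappa=H$, and the Pick invariant vanishes, $J=0$. -/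

import Mathlib

open scoped Manifold ContDiff

noncomputable section

namespace AffineGeometry

/-- The model space of a 3-dimensional manifold, also used as coordinate space. -/
abbrev E3 := EuclideanSpace ℝ (Fin 3)

/-- The ambient affine space. -/
abbrev E4 := EuclideanSpace ℝ (Fin 4)

/-! ### Pseudo-Riemannian geometry in a coordinate domain

`g : E3 → E3 →L[ℝ] E3 →L[ℝ] ℝ` is a field of symmetric nondegenerate bilinear forms. -/

section Metric

variable (g : E3 → E3 →L[ℝ] E3 →L[ℝ] ℝ) (x : E3)

/-- Christoffel symbols of the first kind, as a linear form in `Z`: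
`(X, Y, Z) ↦ (D_X g(Y,Z) + D_Y g(X,Z) - D_Z g(X,Y)) / 2`. -/
def christoffelFirst (X Y : E3) : E3 →L[ℝ] ℝ :=
  (1 / 2 : ℝ) • (fderiv ℝ g x X Y + fderiv ℝ g x Y X - ((fderiv ℝ g x).flip X).flip Y)

/-- Christoffel symbols of the Levi-Civita connection: the vector `W` with
`g(W, Z) = christoffelFirst g x X Y Z` for all `Z`. In coordinates
`∇̂_X Y = D_X Y + leviCivita g x X Y`. -/
def leviCivita (X Y : E3) : E3 :=
  (g x).inverse (christoffelFirst g x X Y)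

/-- The curvature tensor `R̂(X,Y)Z = ∇̂_X ∇̂_Y Z - ∇̂_Y ∇̂_X Z` (for vector fields with
constant coordinates `X, Y, Z`). -/
def riemann (X Y Z : E3) : E3 :=
  fderiv ℝ (fun y => leviCivita g y Y Z) x X - fderiv ℝ (fun y => leviCivita g y X Z) x Y
    + leviCivita g x X (leviCivita g x Y Z) - leviCivita g x Y (leviCivita g x X Z)

/-- The denominator of the sectional curvature; nonzero if and only if `X, Y` span a
nondegenerate plane (for symmetric nondegenerate `g x`). -/
def planeForm (X Y : E3) : ℝ := g x X X * g x Y Y - g x X Y ^ 2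

/-- The sectional curvature of the plane spanned by `X, Y`. -/
def sectionalCurvature (X Y : E3) : ℝ := g x (riemann g x X Y Y) X / planeForm g x X Y

/-- The coordinate basis. -/
def coordVec (i : Fin 3) : E3 := EuclideanSpace.single i 1

/-- The inverse `g^{ij}` of the Gram matrix in the coordinate basis. -/
def inverseMetric : Matrix (Fin 3) (Fin 3) ℝ :=
  (Matrix.of fun i j => g x (coordVec i) (coordVec j))⁻¹

/-- The Ricci tensor, `trace (Z ↦ R̂(Z,X)Y)`. -/
def ricci (X Y : E3) : ℝ := ∑ i, (riemann g x (coordVec i) X Y) i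

/-- The normalized scalar curvature `κ̂ = (1/(n(n-1))) ∑ g^{ij} Ric_{ij}`, here `n = 3`. -/
def scalarCurvature : ℝ :=
  (1 / 6 : ℝ) * ∑ i, ∑ j, inverseMetric g x i j * ricci g x (coordVec i) (coordVec j)

end Metric

/-! ### Equiaffine hypersurface theory in a coordinate domain

`f : E3 → E4` is a parametrized hypersurface and `ξ : E3 → E4` a vector field along it. -/

section Hypersurface

variable (f ξ : E3 → E4) (x : E3)

/-- `(X, a) ↦ df(X) + a ξ`, an isomorphism if `f` is an immersion and `ξ` is transverse. -/
def frameMap : E3 × ℝ →L[ℝ] E4 :=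
  (fderiv ℝ f x).coprod (ContinuousLinearMap.toSpanSingleton ℝ (ξ x))

/-- For `v = df(X) + a ξ`, the tangential part `X`. -/
def tangentialPart : E4 →L[ℝ] E3 :=
  (ContinuousLinearMap.fst ℝ E3 ℝ).comp (frameMap f ξ x).inverse

/-- For `v = df(X) + a ξ`, the transversal part `a`. -/
def transversalPart : E4 →L[ℝ] ℝ :=
  (ContinuousLinearMap.snd ℝ E3 ℝ).comp (frameMap f ξ x).inverse

/-- Christoffel symbols `Γ` of the induced connection `∇`, by the Gauss formula
`D²f(X,Y) = df(Γ(X,Y)) + h(X,Y) ξ`. In coordinates `∇_X Y = D_X Y + Γ(X,Y)`. -/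
def inducedConnection : E3 →L[ℝ] E3 →L[ℝ] E3 :=
  (ContinuousLinearMap.compL ℝ E3 E4 E3 (tangentialPart f ξ x)).comp
    (fderiv ℝ (fderiv ℝ f) x)

/-- The affine metric `h`, by the Gauss formula `D²f(X,Y) = df(Γ(X,Y)) + h(X,Y) ξ`. -/
def affineMetric : E3 →L[ℝ] E3 →L[ℝ] ℝ :=
  (ContinuousLinearMap.compL ℝ E3 E4 ℝ (transversalPart f ξ x)).comp
    (fderiv ℝ (fderiv ℝ f) x)

/-- The affine shape operator `S`, by the Weingarten formula `D_X ξ = -df(S X)`. -/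
def shapeOperator : E3 →L[ℝ] E3 :=
  -(tangentialPart f ξ x).comp (fderiv ℝ ξ x)

/-- The difference tensor `K(X,Y) = ∇_X Y - ∇̂_X Y`. -/
def differenceTensor (X Y : E3) : E3 :=
  inducedConnection f ξ x X Y - leviCivita (affineMetric f ξ) x X Y

/-- The Pick invariant `J = (1/(n(n-1))) h(K,K)`, here `n = 3`. -/
def pickInvariant : ℝ :=
  (1 / 6 : ℝ) * ∑ i, ∑ j, ∑ k, ∑ l,
    inverseMetric (affineMetric f ξ) x i j * inverseMetric (affineMetric f ξ) x k l *
      affineMetric f ξ x (differenceTensor f ξ x (coordVec i) (coordVec k))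
        (differenceTensor f ξ x (coordVec j) (coordVec l))

/-- The conditions that make `ξ` (up to sign) the affine (Blaschke) normal at a point of a
nondegenerate hypersurface. -/
structure IsBlaschkeNormalAt : Prop where
  /-- `ξ` is transverse -/
  transverse : ξ x ∉ Set.range (fderiv ℝ f x)
  /-- `Dξ` is tangential -/
  tangential : ∀ X, fderiv ℝ ξ x X ∈ Set.range (fderiv ℝ f x)
  /-- the affine metric is nondegenerate -/
  nondegenerate : ∀ X, (∀ Y, affineMetric f ξ x X Y = 0) → X = 0
  /-- `|θ| = ω_h`, where `θ(X₀,X₁,X₂) = det(df X₀, df X₁, df X₂, ξ)` and `ω_h = |det h|^{1/2}` -/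
  volume : ∀ X : Fin 3 → E3,
    (Matrix.of fun i j : Fin 4 =>
      (![fderiv ℝ f x (X 0), fderiv ℝ f x (X 1), fderiv ℝ f x (X 2), ξ x] i) j).det ^ 2
      = |(Matrix.of fun i j : Fin 3 => affineMetric f ξ x (X i) (X j)).det|

end Hypersurface

/-! ### Pointwise symmetry -/

/-- The special orthogonal group of a bilinear form on a tangent space. -/
def specialOrthogonal (h : E3 →L[ℝ] E3 →L[ℝ] ℝ) : Subgroup (E3 ≃ₗ[ℝ] E3) where
  carrier := {L | (∀ X Y, h (L X) (L Y) = h X Y) ∧ LinearEquiv.det L = 1}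
  one_mem' := ⟨fun _ _ => rfl, map_one _⟩
  mul_mem' := by
    rintro L L' ⟨h1, h2⟩ ⟨h1', h2'⟩
    exact ⟨fun X Y => by simp [h1, h1'], by rw [map_mul, h2, h2', mul_one]⟩
  inv_mem' := by
    rintro L ⟨h1, h2⟩
    refine ⟨fun X Y => ?_, by rw [map_inv, h2, inv_one]⟩
    have := h1 (L⁻¹ X) (L⁻¹ Y)
    simpa [← LinearEquiv.mul_apply] using this.symm

/-- The linear automorphisms of a tangent space that preserve a (1,2)-tensor `K`. -/
def tensorStabilizer (K : E3 → E3 → E3) : Subgroup (E3 ≃ₗ[ℝ] E3) where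
  carrier := {L | ∀ X Y, K (L X) (L Y) = L (K X Y)}
  one_mem' := fun _ _ => rfl
  mul_mem' := by
    intro L L' h1 h1' X Y
    simp only [LinearEquiv.mul_apply]
    rw [h1, h1']
  inv_mem' := by
    intro L h1 X Y
    apply L.injective
    have := h1 (L⁻¹ X) (L⁻¹ Y)
    simp only [← LinearEquiv.mul_apply, mul_inv_cancel, LinearEquiv.coe_one, id] at this ⊢
    exact this.symm

/-- A (1,2)-tensor `C` such that `h(C(X,Y),Z)` is totally symmetric and all `C(X,·)` are
traceless, i.e. (via `h`) a traceless cubic form. -/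
structure IsTracelessCubic (h : E3 →L[ℝ] E3 →L[ℝ] ℝ) (C : E3 →ₗ[ℝ] E3 →ₗ[ℝ] E3) : Prop where
  symm : ∀ X Y, C X Y = C Y X
  symm' : ∀ X Y Z, h (C X Y) Z = h (C X Z) Y
  trace : ∀ X, LinearMap.trace ℝ E3 (C X) = 0

/-- Symmetry under the group `G` at one point. The symmetry groups of type `G` are the groups of
isometries of determinant one that are isomorphic to `G` and occur as the full stabilizer of a
traceless cubic form `C`; one of them has to preserve, besides `h`, the difference tensor and the
shape operator. (It may be the full stabilizer of the difference tensor, or a smaller group.) -/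
def HasSymmetryAt (G : Type*) [Group G] (f ξ : E3 → E4) (x : E3) : Prop :=
  ∃ C : E3 →ₗ[ℝ] E3 →ₗ[ℝ] E3, IsTracelessCubic (affineMetric f ξ x) C ∧
    Nonempty (G ≃* ↥(specialOrthogonal (affineMetric f ξ x) ⊓
      tensorStabilizer fun X Y => C X Y)) ∧
    ∀ L ∈ specialOrthogonal (affineMetric f ξ x) ⊓ tensorStabilizer (fun X Y => C X Y),
      L ∈ tensorStabilizer (differenceTensor f ξ x) ∧
      ∀ X, shapeOperator f ξ x (L X) = L (shapeOperator f ξ x X)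

/-! ### Immersed hypersurfaces -/

section Global

variable {M : Type*} [TopologicalSpace M] [ChartedSpace E3 M]

/-- A coordinate independent property of `(φ, ξ)` holds at every point: it holds for the
coordinate expressions of `φ` and `ξ` in every chart, at every point of the chart. -/
def Everywhere (φ ξ : M → E4) (P : (E3 → E4) → (E3 → E4) → E3 → Prop) : Prop :=
  ∀ e ∈ IsManifold.maximalAtlas (𝓡 3) ∞ M, ∀ x ∈ e.target, P (φ ∘ e.symm) (ξ ∘ e.symm) x

/-- `φ` is an immersed nondegenerate hypersurface with affine (Blaschke) normal `ξ`. -/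
structure IsBlaschkeHypersurface (φ ξ : M → E4) : Prop where
  smooth : ContMDiff (𝓡 3) 𝓘(ℝ, E4) ∞ φ
  immersion : ∀ p, Function.Injective (mfderiv (𝓡 3) 𝓘(ℝ, E4) φ p)
  smooth_normal : ContMDiff (𝓡 3) 𝓘(ℝ, E4) ∞ ξ
  blaschke : Everywhere φ ξ IsBlaschkeNormalAt

/-- An affine hypersphere: the shape operator is `H` times the identity, with `H` constant. -/
structure IsAffineHypersphere (φ ξ : M → E4) (H : ℝ) : Prop extends
    IsBlaschkeHypersurface φ ξ where
  shape : Everywhere φ ξ fun f ξ x => ∀ X, shapeOperator f ξ x X = H • X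

/-- The affine metric is indefinite. -/
def IsIndefinite (φ ξ : M → E4) : Prop :=
  Everywhere φ ξ fun f ξ x =>
    (∃ X, 0 < affineMetric f ξ x X X) ∧ ∃ X, affineMetric f ξ x X X < 0

/-- The hypersurface admits a pointwise `G`-symmetry. -/
def AdmitsPointwiseSymmetry (G : Type*) [Group G] (φ ξ : M → E4) : Prop :=
  Everywhere φ ξ (HasSymmetryAt G)

/-- The affine metric has constant sectional curvature `c`. -/
def HasConstantSectionalCurvature (φ ξ : M → E4) (c : ℝ) : Prop :=
  Everywhere φ ξ fun f ξ x => ∀ X Y, planeForm (affineMetric f ξ) x X Y ≠ 0 →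
    sectionalCurvature (affineMetric f ξ) x X Y = c

end Global

end AffineGeometry

end

/-! The symmetry forces the difference tensor to be a multiple of the cube of an isotropic covector,
and then it contributes neither to the curvature of `h` nor to the Pick invariant.

Pointwise part. A group isomorphic to `ℝ` has no torsion. Let `L` be a nontrivial element of the
stabilizer of the cubic form `C`. In dimension three it fixes some `v ≠ 0` (`exists_fixed_vector`).
If `v` is nonisotropic, split traceless cubic forms into weights 0 to 3 under the rotations or
boosts of the plane orthogonal to `v`. Since neither `L` nor `L ^ 3` is the identity, `C` has no
part of weight 1 or 3. The half turn about `v` acts on weight `k` by `(-1) ^ k`, so it preserves `C`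
(`halfTurn_invariant`) and is an element of order two in the stabilizer, which is impossible. Hence
`v` is isotropic (`exists_isotropic_fixed`), and `L` is unipotent with a single Jordan block. On the
7-dimensional irreducible space of traceless cubic forms such an `L` fixes only the line of cubes of
the covector `h v` (`eq_smul_of_isotropic`). Since `L` also preserves `K`, this applies to `K`.

Differential part. Symmetry of third derivatives of the immersion gives the Gauss and Codazzi
equations (`gauss_codazzi`). Codazzi makes `h(K(X,Y),Z)` totally symmetric, and the volume condition
makes `K` traceless, so `K` is a traceless cubic form. The induced connection and its conjugate, the
Levi-Civita connection plus and minus `K`, have the same curvature, that of constant curvature `H`.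
Averaging gives `riemann_eq`: the curvature of `h` is this constant curvature expression minus the
commutator of `K(W,·)` and `K(X,·)`. For `K(X,Y) = c h(e,X) h(e,Y) e` with `h(e,e) = 0`, both the
commutator and `h(K,K)` vanish. -/

noncomputable section

namespace AffineGeometry

/-! ### Linear algebra of a nondegenerate symmetric form on a three-dimensional space -/

section Algebra

variable {h : E3 →L[ℝ] E3 →L[ℝ] ℝ}

/-- `b` and `d` are dual frames with respect to `h`. -/
structure IsDualFrame (h : E3 →L[ℝ] E3 →L[ℝ] ℝ) (b d : Fin 3 → E3) : Prop where
  pairing : ∀ i j, h (b i) (d j) = if i = j then 1 else 0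

namespace IsDualFrame

variable {b d : Fin 3 → E3}

theorem linearIndependent (hbd : IsDualFrame h b d) : LinearIndependent ℝ b := by
  rw [Fintype.linearIndependent_iff]
  intro c hc i
  have := congrArg (fun u => h u (d i)) hc
  simpa [hbd.pairing, map_sum, sum_apply] using this

/-- The basis underlying a dual frame. -/
def basis (hbd : IsDualFrame h b d) : Module.Basis (Fin 3) ℝ E3 :=
  basisOfLinearIndependentOfCardEqFinrank hbd.linearIndependent (by simp)

@[simp] theorem basis_apply (hbd : IsDualFrame h b d) (i : Fin 3) : hbd.basis i = b i := by
  simp [basis]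

theorem repr_apply (hbd : IsDualFrame h b d) (u : E3) (i : Fin 3) :
    hbd.basis.repr u i = h u (d i) := by
  conv_rhs => rw [← hbd.basis.sum_repr u]
  simp [hbd.pairing, map_sum]

theorem sum_smul (hbd : IsDualFrame h b d) (u : E3) : ∑ i, h u (d i) • b i = u := by
  conv_rhs => rw [← hbd.basis.sum_repr u]
  simp [hbd.repr_apply]

theorem trace_eq (hbd : IsDualFrame h b d) (T : E3 →ₗ[ℝ] E3) :
    LinearMap.trace ℝ E3 T = ∑ i, h (T (b i)) (d i) := by
  rw [LinearMap.trace_eq_matrix_trace ℝ hbd.basis]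
  simp [Matrix.trace, LinearMap.toMatrix_apply, hbd.repr_apply]

theorem det_eq (hbd : IsDualFrame h b d) (T : E3 →ₗ[ℝ] E3) :
    LinearMap.det T = (Matrix.of fun i j => h (T (b j)) (d i)).det := by
  rw [← LinearMap.det_toMatrix hbd.basis]
  congr 1
  ext i j
  simp [LinearMap.toMatrix_apply, hbd.repr_apply]

theorem hom_ext {F : Type*} [AddCommGroup F] [Module ℝ F] (hbd : IsDualFrame h b d)
    {S T : E3 →ₗ[ℝ] F} (hST : ∀ i, S (b i) = T (b i)) : S = T :=
  hbd.basis.ext fun i => by simpa using hST i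

end IsDualFrame

theorem exists_common_orthogonal (h : E3 →L[ℝ] E3 →L[ℝ] ℝ) (u v : E3) :
    ∃ y, y ≠ 0 ∧ h u y = 0 ∧ h v y = 0 := by
  let T : E3 →ₗ[ℝ] ℝ × ℝ := (h u : E3 →ₗ[ℝ] ℝ).prod (h v : E3 →ₗ[ℝ] ℝ)
  have hker : LinearMap.ker T ≠ ⊥ := LinearMap.ker_ne_bot_of_finrank_lt (by simp)
  obtain ⟨y, hy, hy0⟩ := (Submodule.ne_bot_iff _).1 hker
  have : (h u y, h v y) = 0 := hy
  exact ⟨y, hy0, congrArg Prod.fst this, congrArg Prod.snd this⟩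

/-- A nonisotropic vector is the first vector of an orthogonal frame. -/
theorem exists_orthogonal_frame (hs : ∀ X Y, h X Y = h Y X)
    (hn : ∀ X, (∀ Y, h X Y = 0) → X = 0) {v : E3} (hv : h v v ≠ 0) :
    ∃ x y, h v x = 0 ∧ h v y = 0 ∧ h x y = 0 ∧ h x x ≠ 0 ∧ h y y ≠ 0 := by
  have split : ∀ Y : E3, ∃ Z, h v Z = 0 ∧ Y = (h v Y / h v v) • v + Z := fun Y =>
    ⟨Y - (h v Y / h v v) • v, by simp [hv], by abel⟩
  have hx : ∃ x, h v x = 0 ∧ h x x ≠ 0 := by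
    by_contra! hcon
    -- If every vector orthogonal to `v` were isotropic, polarization would make such a `z`
    -- orthogonal to all of them and to `v`, hence to everything.
    obtain ⟨z, hz0, hz, -⟩ := exists_common_orthogonal h v v
    refine hz0 (hn z fun Y => ?_)
    obtain ⟨Z, hZ, hY⟩ := split Y
    have h1 := hcon (z + Z) (by simp [hz, hZ])
    have h2 := hcon z hz
    have h3 := hcon Z hZ
    simp only [map_add, add_apply] at h1
    rw [hY]
    simp only [map_add, map_smul, smul_eq_mul, hs z v, hz]
    rw [hs Z z] at h1
    linarith
  obtain ⟨x, hvx, hxx⟩ := hx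
  obtain ⟨y, hy0, hvy, hxy⟩ := exists_common_orthogonal h v x
  refine ⟨x, y, hvx, hvy, hxy, hxx, fun hyy => ?_⟩
  have hbd : LinearIndependent ℝ ![v, x, y] := by
    rw [Fintype.linearIndependent_iff]
    intro c hc
    have e : c 0 • v + c 1 • x + c 2 • y = 0 := by simpa [Fin.sum_univ_three] using hc
    have e0 : c 0 = 0 := by
      have := congrArg (h v) e
      simpa [hvx, hvy, hv] using this
    have e1 : c 1 = 0 := by
      have := congrArg (h x) e
      simpa [hs x v, hvx, hxy, hxx] using this
    have e2 : c 2 = 0 := by simpa [e0, e1, hy0] using e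
    intro i
    fin_cases i <;> assumption
  let B := basisOfLinearIndependentOfCardEqFinrank hbd (by simp)
  refine hy0 (hn y fun Y => ?_)
  rw [← B.sum_repr Y]
  simp [B, Fin.sum_univ_three, hs y v, hs y x, hvy, hxy, hyy]

theorem isDualFrame_of_orthogonal (hs : ∀ X Y, h X Y = h Y X) {v x y : E3} (hv : h v v ≠ 0)
    (hx : h x x ≠ 0) (hy : h y y ≠ 0) (hvx : h v x = 0) (hvy : h v y = 0) (hxy : h x y = 0) :
    IsDualFrame h ![v, x, y] ![(h v v)⁻¹ • v, (h x x)⁻¹ • x, (h y y)⁻¹ • y] := by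
  refine ⟨fun i j => ?_⟩
  fin_cases i <;> fin_cases j <;> simp [hs x v, hs y v, hs y x, *]

/-- A nonzero isotropic vector is the first vector of a null frame. -/
theorem exists_null_frame (hs : ∀ X Y, h X Y = h Y X)
    (hn : ∀ X, (∀ Y, h X Y = 0) → X = 0) {e : E3} (he : e ≠ 0) (hee : h e e = 0) :
    ∃ w f, h e w = 0 ∧ h e f = 1 ∧ h w f = 0 ∧ h f f = 0 ∧ h w w ≠ 0 := by
  obtain ⟨f', hf'⟩ : ∃ f, h e f ≠ 0 := by
    by_contra! hcon
    exact he (hn e hcon)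
  let f'' := (h e f')⁻¹ • f'
  have hef'' : h e f'' = 1 := by simp [f'', hf']
  -- Subtracting a multiple of the isotropic `e` keeps the pairing with `e` equal to 1; this
  -- coefficient cancels `h f'' f''`.
  let f := f'' - (h f'' f'' / 2) • e
  have hef : h e f = 1 := by simp [f, hef'', hee]
  have hff : h f f = 0 := by
    simp only [f, map_sub, map_smul, sub_apply, smul_apply,
      smul_eq_mul, hef'', hee, hs f'' e]
    ring
  obtain ⟨w, hw0, hew, hfw⟩ := exists_common_orthogonal h e f
  refine ⟨w, f, hew, hef, by rw [hs, hfw], hff, fun hww => ?_⟩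
  have hbd : LinearIndependent ℝ ![e, w, f] := by
    rw [Fintype.linearIndependent_iff]
    intro c hc
    have e' : c 0 • e + c 1 • w + c 2 • f = 0 := by simpa [Fin.sum_univ_three] using hc
    have e2 : c 2 = 0 := by
      have := congrArg (h e) e'
      simpa [hee, hew, hef] using this
    have e0 : c 0 = 0 := by
      have := congrArg (h f) e'
      simpa [hs f e, hef, hfw, hff] using this
    have e1 : c 1 = 0 := by simpa [e0, e2, hw0] using e'
    intro i
    fin_cases i <;> assumption
  let B := basisOfLinearIndependentOfCardEqFinrank hbd (by simp)
  refine hw0 (hn w fun Y => ?_)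
  rw [← B.sum_repr Y]
  simp [B, Fin.sum_univ_three, hs w e, hs w f, hew, hfw, hww]

theorem isDualFrame_of_null (hs : ∀ X Y, h X Y = h Y X) {e w f : E3} (hee : h e e = 0)
    (hew : h e w = 0) (hef : h e f = 1) (hwf : h w f = 0) (hff : h f f = 0) (hww : h w w ≠ 0) :
    IsDualFrame h ![e, w, f] ![f, (h w w)⁻¹ • w, e] := by
  refine ⟨fun i j => ?_⟩
  fin_cases i <;> fin_cases j <;> simp [hs w e, hs f e, hs f w, *]

theorem sum_smul_coordVec (X : E3) : ∑ i, X i • coordVec i = X := by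
  simpa [coordVec] using (EuclideanSpace.basisFun (Fin 3) ℝ).sum_repr X

theorem det_gram_ne_zero (hn : ∀ X, (∀ Y, h X Y = 0) → X = 0) :
    (Matrix.of fun i j => h (coordVec i) (coordVec j)).det ≠ 0 := by
  intro h0
  obtain ⟨c, hc0, hc⟩ := Matrix.exists_vecMul_eq_zero_iff.2 h0
  refine hc0 (funext fun k => ?_)
  have hX : ∑ i, c i • coordVec i = 0 := by
    refine hn _ fun Y => ?_
    rw [← sum_smul_coordVec Y, map_sum]
    refine Finset.sum_eq_zero fun j _ => ?_
    have := congrFun hc j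
    simp only [Matrix.vecMul, dotProduct, Matrix.of_apply, Pi.zero_apply] at this
    simp [map_sum, this]
  simpa [coordVec, Finset.sum_apply, Pi.single_apply] using congrArg (fun u : E3 => u k) hX

/-- An isometry of determinant one of a three-dimensional space has a nonzero fixed vector. -/
theorem exists_fixed_vector (hn : ∀ X, (∀ Y, h X Y = 0) → X = 0) {L : E3 ≃ₗ[ℝ] E3}
    (hL : L ∈ specialOrthogonal h) : ∃ v, v ≠ 0 ∧ L v = v := by
  obtain ⟨hiso, hdet⟩ := hL
  have hdet' : LinearMap.det (L : E3 →ₗ[ℝ] E3) = 1 := by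
    rw [← LinearEquiv.coe_det, hdet, Units.val_one]
  let b := (EuclideanSpace.basisFun (Fin 3) ℝ).toBasis
  let B : LinearMap.BilinForm ℝ E3 := LinearMap.mk₂ ℝ (fun X Y => h X Y)
    (by simp) (by simp) (by simp) (by simp)
  have hB : LinearMap.det ((L : E3 →ₗ[ℝ] E3) - 1) = 0 := by
    have hBn : (LinearMap.BilinForm.toMatrix b B).det ≠ 0 := by
      convert det_gram_ne_zero hn using 2
      ext i j
      simp [LinearMap.BilinForm.toMatrix_apply, B, b, coordVec]
    -- Both sides are `h(X,Y) - h(LX,Y)`. As `det L = 1` and the dimension is odd, taking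
    -- determinants gives `det (L - 1) = -det (L - 1)` up to the nonzero Gram determinant.
    have key : B.comp (L : E3 →ₗ[ℝ] E3) ((L : E3 →ₗ[ℝ] E3) - 1)
        = B.comp ((-1 : ℝ) • ((L : E3 →ₗ[ℝ] E3) - 1)) 1 := by
      ext X Y
      simp [B, hiso]
    have := congrArg (fun Q => (LinearMap.BilinForm.toMatrix b Q).det) key
    simp only [LinearMap.BilinForm.toMatrix_comp b b, Matrix.det_mul,
      Matrix.det_transpose, LinearMap.det_toMatrix, hdet', LinearMap.det_smul, map_one,
      one_mul, mul_one, finrank_euclideanSpace_fin] at this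
    have h2 : 2 * ((LinearMap.BilinForm.toMatrix b B).det
      * LinearMap.det ((L : E3 →ₗ[ℝ] E3) - 1)) = 0 := by linarith
    simpa [hBn] using h2
  obtain ⟨v, hv, hv0⟩ := (Submodule.ne_bot_iff _).1 (LinearMap.bot_lt_ker_of_det_eq_zero hB).ne'
  refine ⟨v, hv0, sub_eq_zero.1 (by simpa using hv)⟩

end Algebra

/-! ### Traceless cubic forms preserved by an isometry of determinant one -/

section CubicForms

variable {h : E3 →L[ℝ] E3 →L[ℝ] ℝ}

/-- The half turn about the line spanned by the vector `v`. -/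
def halfTurn (h : E3 →L[ℝ] E3 →L[ℝ] ℝ) (v : E3) : E3 →ₗ[ℝ] E3 :=
  (LinearMap.toSpanSingleton ℝ E3 ((2 / h v v) • v)).comp (h v : E3 →ₗ[ℝ] ℝ) - LinearMap.id

theorem halfTurn_apply (v X : E3) : halfTurn h v X = (h v X * (2 / h v v)) • v - X := by
  simp [halfTurn, smul_smul]

theorem halfTurn_self {v : E3} (hv : h v v ≠ 0) : halfTurn h v v = v := by
  rw [halfTurn_apply, mul_div_cancel₀ _ hv, two_smul, add_sub_cancel_right]

theorem halfTurn_of_orthogonal {v X : E3} (hX : h v X = 0) : halfTurn h v X = -X := by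
  simp [halfTurn_apply, hX]

theorem halfTurn_involutive {v : E3} (hv : h v v ≠ 0) : Function.Involutive (halfTurn h v) := by
  intro X
  rw [halfTurn_apply v X, map_sub, map_smul, halfTurn_self hv, halfTurn_apply, sub_sub_cancel]

/-- A traceless cubic form that is preserved by an isometry `L` of determinant one with a
nonisotropic fixed vector `v` is invariant under the half turn about `v`, unless `L ^ 3 = 1`. -/
theorem halfTurn_invariant (hs : ∀ X Y, h X Y = h Y X)
    (hn : ∀ X, (∀ Y, h X Y = 0) → X = 0) {C : E3 →ₗ[ℝ] E3 →ₗ[ℝ] E3}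
    (hC : IsTracelessCubic h C) {L : E3 ≃ₗ[ℝ] E3}
    (hL : L ∈ specialOrthogonal h) (hLC : L ∈ tensorStabilizer fun X Y => C X Y)
    {v : E3} (hv : h v v ≠ 0) (hLv : L v = v) (hL3 : L ^ 3 ≠ 1) (X Y : E3) :
    C (halfTurn h v X) (halfTurn h v Y) = halfTurn h v (C X Y) := by
  obtain ⟨x, y, hvx, hvy, hxy, hx, hy⟩ := exists_orthogonal_frame hs hn hv
  have hF := isDualFrame_of_orthogonal hs hv hx hy hvx hvy hxy
  have hxv : h x v = 0 := by rw [hs, hvx]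
  have hyv : h y v = 0 := by rw [hs, hvy]
  have hyx : h y x = 0 := by rw [hs, hxy]
  obtain ⟨hiso, hdet⟩ := hL
  have expand : ∀ u, u = (h u v * (h v v)⁻¹) • v + (h u x * (h x x)⁻¹) • x
      + (h u y * (h y y)⁻¹) • y := fun u => by
    conv_lhs => rw [← hF.sum_smul u]
    simp [Fin.sum_univ_three, mul_comm]
  have perp : ∀ u, h v u = 0 → h (L u) v = 0 := fun u hu => by
    rw [← hLv, hiso, hs, hu]
  obtain ⟨a, b, hLx⟩ : ∃ a b, L x = a • x + b • y :=
    ⟨_, _, by simpa [perp x hvx] using expand (L x)⟩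
  obtain ⟨c, d, hLy⟩ : ∃ c d, L y = c • x + d • y :=
    ⟨_, _, by simpa [perp y hvy] using expand (L y)⟩
  set α := h x x with hα
  set β := h y y with hβ
  have e1 : α * a ^ 2 + β * b ^ 2 = α := by
    have := hiso x x
    simp only [hLx, map_add, map_smul, add_apply, smul_apply, smul_eq_mul, hxy, hyx, ← hα,
      ← hβ] at this
    linarith
  have e2 : α * c ^ 2 + β * d ^ 2 = β := by
    have := hiso y y
    simp only [hLy, map_add, map_smul, add_apply, smul_apply, smul_eq_mul, hxy, hyx, ← hα,
      ← hβ] at this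
    linarith
  have e3 : α * a * c + β * b * d = 0 := by
    have := hiso x y
    simp only [hLx, hLy, map_add, map_smul, add_apply, smul_apply, smul_eq_mul, hxy, hyx, ← hα,
      ← hβ] at this
    linarith
  have e4 : a * d - b * c = 1 := by
    have h1 : LinearMap.det (L : E3 →ₗ[ℝ] E3) = 1 := by
      rw [← LinearEquiv.coe_det, hdet, Units.val_one]
    rw [hF.det_eq, Matrix.det_fin_three] at h1
    simp [hLv, hLx, hLy, hv, hvx, hvy, hxv, hyv, hxy, hyx, ← hα, ← hβ] at h1
    field_simp at h1
    linarith
  -- With `γ = h y y / h x x`, the relations show that on the span of `x, y` (read as `1, √(-γ)`)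
  -- the map `L` is multiplication by `d + b √(-γ)`, an element of norm `d ^ 2 + γ b ^ 2 = 1`.
  have hd : d = a := by
    have : α * (d - a) = 0 := by linear_combination (-d) * e1 + b * e3 + α * a * e4
    simpa [hx, sub_eq_zero] using this
  obtain ⟨γ, hγ⟩ : ∃ γ, β = α * γ := ⟨β / α, by field_simp⟩
  have hγ0 : γ ≠ 0 := by rintro rfl; exact hy (by simpa using hγ)
  have hc : c = -γ * b := by
    have : α * (c + γ * b) = 0 := by
      subst hd
      rw [hγ] at e1 e2 e3
      linear_combination d * e3 - α * c * e4 - b * e2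
    have := (mul_eq_zero.1 this).resolve_left hx
    linarith
  subst hd hc
  have hβα : β = α * γ := hγ
  have e5 : d ^ 2 + γ * b ^ 2 = 1 := by
    have : α * (d ^ 2 + γ * b ^ 2 - 1) = 0 := by rw [hγ] at e1; linear_combination e1
    have := (mul_eq_zero.1 this).resolve_left hx
    linarith
  have hd1 : d ≠ 1 := by
    rintro rfl
    have hb : b = 0 := by simpa [hγ0] using e5
    subst hb
    refine hL3 ?_
    have : (L : E3 →ₗ[ℝ] E3) = LinearMap.id := hF.hom_ext fun i => by
      fin_cases i <;> simp [hLv, hLx, hLy]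
    have hL1 : L = 1 := LinearEquiv.toLinearMap_injective this
    rw [hL1, one_pow]
  -- This is the real part of the cube of `d + b √(-γ)`. The cube has norm one, so real part 1 would
  -- force it to be 1, that is `L ^ 3 = 1`.
  have hA1 : d ^ 3 - 3 * γ * d * b ^ 2 ≠ 1 := by
    intro hA
    have hB : γ * (3 * d ^ 2 * b - γ * b ^ 3) ^ 2 = 0 := by
      have : (d ^ 3 - 3 * γ * d * b ^ 2) ^ 2 + γ * (3 * d ^ 2 * b - γ * b ^ 3) ^ 2
          = (d ^ 2 + γ * b ^ 2) ^ 3 := by ring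
      rw [hA, e5] at this
      linarith
    replace hB : 3 * d ^ 2 * b - γ * b ^ 3 = 0 := by simpa [hγ0] using hB
    refine hL3 ?_
    have : ((L ^ 3 : E3 ≃ₗ[ℝ] E3) : E3 →ₗ[ℝ] E3) = LinearMap.id := hF.hom_ext fun i => by
      have hpow : ∀ z, (L ^ 3) z = L (L (L z)) := fun z => rfl
      fin_cases i
      · simp [hpow, hLv]
      · have : (L ^ 3) x = (d ^ 3 - 3 * γ * d * b ^ 2) • x + (3 * d ^ 2 * b - γ * b ^ 3) • y := by
          simp only [hpow, hLx, hLy, map_add, map_smul]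
          module
        simpa [hA, hB] using this
      · have : (L ^ 3) y = (d ^ 3 - 3 * γ * d * b ^ 2) • y
            + (-γ * (3 * d ^ 2 * b - γ * b ^ 3)) • x := by
          simp only [hpow, hLx, hLy, map_add, map_smul]
          module
        simpa [hA, hB] using this
    exact LinearEquiv.toLinearMap_injective this
  have inv : ∀ U V W, h (C (L U) (L V)) (L W) = h (C U V) W := fun U V W => by
    rw [show C (L U) (L V) = L (C U V) from hLC U V, hiso]
  have kxv : h (C x v) v = h (C v v) x := by rw [hC.symm, hC.symm']
  have kyv : h (C y v) v = h (C v v) y := by rw [hC.symm, hC.symm']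
  have kxyx : h (C x y) x = h (C x x) y := hC.symm' _ _ _
  have kyx : C y x = C x y := hC.symm _ _
  have kyyx : h (C y y) x = h (C x y) y := by rw [hC.symm' y y x, kyx]
  have tx : h (C v v) x / h v v + h (C x x) x / α + h (C x y) y / β = 0 := by
    have := hC.trace x
    rw [hF.trace_eq, Fin.sum_univ_three] at this
    simp [kxv] at this
    rw [← this]; ring
  have ty : h (C v v) y / h v v + h (C x x) y / α + h (C y y) y / β = 0 := by
    have := hC.trace y
    rw [hF.trace_eq, Fin.sum_univ_three] at this
    simp [kyv, kyx, kxyx] at this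
    rw [← this]; ring
  have p1 := inv v v x
  have p2 := inv v v y
  have p3 := inv x x x
  have p4 := inv x x y
  simp only [hLv, hLx, hLy, map_add, map_smul, add_apply, LinearMap.add_apply, LinearMap.smul_apply,
    smul_apply, smul_eq_mul, kyx, kyyx, kxyx] at p1 p2 p3 p4
  -- Weight 1: the pair of components of `C v v` along `x, y` is fixed by `L` on the plane, where
  -- `det (L - 1) = 2 - 2d ≠ 0`.
  have hp : h (C v v) x = 0 := by
    have : (2 - 2 * d) * h (C v v) x = 0 := by
      linear_combination (d - 1) * p1 - b * p2 - h (C v v) x * e5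
    exact (mul_eq_zero.1 this).resolve_left fun h0 => hd1 (by linarith)
  have hq : h (C v v) y = 0 := by
    have : (2 - 2 * d) * h (C v v) y = 0 := by
      linear_combination γ * b * p1 + (d - 1) * p2 - h (C v v) y * e5
    exact (mul_eq_zero.1 this).resolve_left fun h0 => hd1 (by linarith)
  -- With weight 1 gone, tracelessness leaves two independent components on the plane. These have
  -- weight 3, so they transform by the cube of `d + b √(-γ)`.
  have ht : h (C x y) y = -γ * h (C x x) x := by
    rw [hp, hβα, zero_div, zero_add] at tx
    field_simp at tx
    linarith
  have hu : h (C y y) y = -γ * h (C x x) y := by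
    rw [hq, hβα, zero_div, zero_add] at ty
    field_simp at ty
    linarith
  rw [ht, hu] at p3 p4
  have hN : (d ^ 3 - 3 * γ * d * b ^ 2) ^ 2 + γ * (3 * d ^ 2 * b - γ * b ^ 3) ^ 2 = 1 := by
    have : (d ^ 3 - 3 * γ * d * b ^ 2) ^ 2 + γ * (3 * d ^ 2 * b - γ * b ^ 3) ^ 2
          = (d ^ 2 + γ * b ^ 2) ^ 3 := by ring
    rw [this, e5, one_pow]
  have p3' : (d ^ 3 - 3 * γ * d * b ^ 2 - 1) * h (C x x) x
      + (3 * d ^ 2 * b - γ * b ^ 3) * h (C x x) y = 0 := by linear_combination p3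
  have p4' : -γ * (3 * d ^ 2 * b - γ * b ^ 3) * h (C x x) x
      + (d ^ 3 - 3 * γ * d * b ^ 2 - 1) * h (C x x) y = 0 := by linear_combination p4
  generalize d ^ 3 - 3 * γ * d * b ^ 2 = A at hA1 hN p3' p4'
  generalize 3 * d ^ 2 * b - γ * b ^ 3 = B at hN p3' p4'
  have hr : h (C x x) x = 0 := by
    have : (2 - 2 * A) * h (C x x) x = 0 := by
      linear_combination (A - 1) * p3' - B * p4' - h (C x x) x * hN
    exact (mul_eq_zero.1 this).resolve_left fun h0 => hA1 (by linarith)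
  have hs' : h (C x x) y = 0 := by
    have : (2 - 2 * A) * h (C x x) y = 0 := by
      linear_combination γ * B * p3' + (A - 1) * p4' - h (C x x) y * hN
    exact (mul_eq_zero.1 this).resolve_left fun h0 => hA1 (by linarith)
  -- The surviving components involve `x, y` an even number of times, and the half turn only changes
  -- the signs of `x` and `y`.
  have along : ∀ U, h U x = 0 → h U y = 0 → halfTurn h v U = U := fun U h1 h2 => by
    rw [expand U, h1, h2]
    simp [halfTurn_self hv]
  have Rv := halfTurn_self hv
  have Rx := halfTurn_of_orthogonal hvx
  have Ry := halfTurn_of_orthogonal hvy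
  have Rvx : halfTurn h v (C v x) = -(C v x) := halfTurn_of_orthogonal (by
    rw [hs, hC.symm', hp])
  have Rvy : halfTurn h v (C v y) = -(C v y) := halfTurn_of_orthogonal (by
    rw [hs, hC.symm', hq])
  have Rvv : halfTurn h v (C v v) = C v v := along _ hp hq
  have Rxx : halfTurn h v (C x x) = C x x := along _ hr hs'
  have Rxy : halfTurn h v (C x y) = C x y := along _ (by rw [kxyx, hs']) (by rw [ht, hr, mul_zero])
  have Ryy : halfTurn h v (C y y) = C y y :=
    along _ (by rw [kyyx, ht, hr, mul_zero]) (by rw [hu, hs', mul_zero])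
  have main : C.compl₁₂ (halfTurn h v) (halfTurn h v) = C.compr₂ (halfTurn h v) :=
    hF.hom_ext fun i => hF.hom_ext fun j => by
      fin_cases i <;> fin_cases j <;>
        simp [Rv, Rx, Ry, Rvx, Rvy, Rvv, Rxx, Rxy, Ryy, kyx, hC.symm x v, hC.symm y v]
  exact LinearMap.congr_fun (LinearMap.congr_fun main X) Y

/-- The half turn about a nonisotropic vector belongs to the special orthogonal group. -/
theorem halfTurn_mem (hs : ∀ X Y, h X Y = h Y X) (hn : ∀ X, (∀ Y, h X Y = 0) → X = 0)
    {v : E3} (hv : h v v ≠ 0) :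
    LinearEquiv.ofInvolutive (halfTurn h v) (halfTurn_involutive hv) ∈ specialOrthogonal h := by
  refine ⟨fun X Y => ?_, ?_⟩
  · simp only [LinearEquiv.coe_ofInvolutive, halfTurn_apply, map_sub, map_smul, sub_apply,
      smul_apply, smul_eq_mul, hs X v]
    field_simp
    ring
  · obtain ⟨x, y, hvx, hvy, hxy, hx, hy⟩ := exists_orthogonal_frame hs hn hv
    have hF := isDualFrame_of_orthogonal hs hv hx hy hvx hvy hxy
    have hxv : h x v = 0 := by rw [hs, hvx]
    have hyv : h y v = 0 := by rw [hs, hvy]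
    have hyx : h y x = 0 := by rw [hs, hxy]
    refine Units.ext ?_
    rw [LinearEquiv.coe_det, Units.val_one, hF.det_eq, Matrix.det_fin_three]
    simp [halfTurn_self hv, halfTurn_of_orthogonal hvx, halfTurn_of_orthogonal hvy, hv, hx, hy,
      hvx, hvy, hxy, hxv, hyv, hyx]

theorem eq_smul_of_null_frame {b d : Fin 3 → E3} (hF : IsDualFrame h b d)
    {K : E3 →ₗ[ℝ] E3 →ₗ[ℝ] E3} {e : E3} {c : ℝ}
    (hK : ∀ i j, K (b i) (b j) = (c * h e (b i) * h e (b j)) • e) (X Y : E3) :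
    K X Y = (c * h e X * h e Y) • e := by
  have main : K = ((LinearMap.mul ℝ ℝ).compl₁₂ (h e : E3 →ₗ[ℝ] ℝ) (h e : E3 →ₗ[ℝ] ℝ)).compr₂
      (LinearMap.toSpanSingleton ℝ E3 (c • e)) :=
    hF.hom_ext fun i => hF.hom_ext fun j => by
      rw [hK]
      simp only [LinearMap.compr₂_apply, LinearMap.compl₁₂_apply, ContinuousLinearMap.coe_coe,
        LinearMap.mul_apply', LinearMap.toSpanSingleton_apply, smul_smul]
      ring_nf
  rw [LinearMap.congr_fun (LinearMap.congr_fun main X) Y]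
  simp only [LinearMap.compr₂_apply, LinearMap.compl₁₂_apply, ContinuousLinearMap.coe_coe,
    LinearMap.mul_apply', LinearMap.toSpanSingleton_apply, smul_smul]
  ring_nf

/-- A traceless cubic form that is preserved by a nontrivial isometry of determinant one with a
nonzero isotropic fixed vector `e` is a multiple of the cube of `h e`. -/
theorem eq_smul_of_isotropic (hs : ∀ X Y, h X Y = h Y X)
    (hn : ∀ X, (∀ Y, h X Y = 0) → X = 0) {K : E3 →ₗ[ℝ] E3 →ₗ[ℝ] E3}
    (hK : IsTracelessCubic h K) {L : E3 ≃ₗ[ℝ] E3}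
    (hL : L ∈ specialOrthogonal h) (hLK : L ∈ tensorStabilizer fun X Y => K X Y) (hL1 : L ≠ 1)
    {e : E3} (he : e ≠ 0) (hee : h e e = 0) (hLe : L e = e) :
    ∃ c : ℝ, ∀ X Y, K X Y = (c * h e X * h e Y) • e := by
  obtain ⟨w, f, hew, hef, hwf, hff, hww⟩ := exists_null_frame hs hn he hee
  have hF := isDualFrame_of_null hs hee hew hef hwf hff hww
  have hwe : h w e = 0 := by rw [hs, hew]
  have hfe : h f e = 1 := by rw [hs, hef]
  have hfw : h f w = 0 := by rw [hs, hwf]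
  obtain ⟨hiso, hdet⟩ := hL
  set ρ := h w w with hρ
  have expand : ∀ u, u = h u f • e + (h u w * ρ⁻¹) • w + h u e • f := fun u => by
    conv_lhs => rw [← hF.sum_smul u]
    simp [Fin.sum_univ_three, mul_comm]
  have hLw0 : h (L w) e = 0 := by rw [← hLe, hiso, hwe]
  have hLf1 : h (L f) e = 1 := by rw [← hLe, hiso, hfe]
  obtain ⟨a, s, hLw⟩ : ∃ a s, L w = a • e + s • w :=
    ⟨_, _, by simpa [hLw0] using expand (L w)⟩
  obtain ⟨q, p, hLf⟩ : ∃ q p, L f = q • e + p • w + f :=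
    ⟨_, _, by simpa [hLf1] using expand (L f)⟩
  have hs1 : s = 1 := by
    have h1 : LinearMap.det (L : E3 →ₗ[ℝ] E3) = 1 := by
      rw [← LinearEquiv.coe_det, hdet, Units.val_one]
    rw [hF.det_eq, Matrix.det_fin_three] at h1
    simp [hLe, hLw, hLf, hee, hew, hef, hwe, hwf, hff, hfe, hfw, ← hρ] at h1
    field_simp at h1
    linarith
  subst hs1
  have e1 : a = -(ρ * p) := by
    have := hiso w f
    simp only [hLw, hLf, map_add, map_smul, add_apply, smul_apply, smul_eq_mul, hee, hew, hef, hwe,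
      hwf, ← hρ] at this
    linarith
  have e2 : 2 * q = -(ρ * p ^ 2) := by
    have := hiso f f
    simp only [hLf, map_add, map_smul, add_apply, smul_apply, smul_eq_mul, hee, hew, hef, hwe,
      hwf, hfe, hfw, hff, ← hρ] at this
    linarith
  -- Now `L` fixes `e`, sends `w` to `w - ρ p e` and `f` to `f + p w - (ρ p ^ 2 / 2) e`; it is
  -- unipotent with one parameter `p`.
  have hp : p ≠ 0 := by
    rintro rfl
    have ha : a = 0 := by simpa using e1
    have hq : q = 0 := by simpa using e2
    subst ha hq
    refine hL1 (LinearEquiv.toLinearMap_injective (hF.hom_ext fun i => ?_))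
    fin_cases i <;> simp [hLe, hLw, hLf]
  have inv : ∀ U V W, h (K (L U) (L V)) (L W) = h (K U V) W := fun U V W => by
    rw [show K (L U) (L V) = L (K U V) from hLK U V, hiso]
  have kwe : K w e = K e w := hK.symm _ _
  have kfe : K f e = K e f := hK.symm _ _
  have kfw : K f w = K w f := hK.symm _ _
  have kewe : h (K e w) e = h (K e e) w := hK.symm' _ _ _
  have kefe : h (K e f) e = h (K e e) f := hK.symm' _ _ _
  have kefw : h (K e f) w = h (K e w) f := hK.symm' _ _ _
  have kwwe : h (K w w) e = h (K e w) w := by rw [hK.symm' w w e, kwe]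
  have kwfe : h (K w f) e = h (K e w) f := by rw [hK.symm' w f e, kwe]
  have kwfw : h (K w f) w = h (K w w) f := hK.symm' _ _ _
  have kffe : h (K f f) e = h (K e f) f := by rw [hK.symm' f f e, kfe]
  have kffw : h (K f f) w = h (K w f) f := by rw [hK.symm' f f w, kfw]
  have te := hK.trace e
  have tw := hK.trace w
  have tf := hK.trace f
  rw [hF.trace_eq, Fin.sum_univ_three] at te tw tf
  simp [kwe, kfe, kfw, kefe, kwfe, kffe, kwfw] at te tw tf
  field_simp at te tw tf
  have p1 := inv e e w
  have p2 := inv e e f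
  have p3 := inv e w f
  have p4 := inv w w f
  have p5 := inv w f f
  have p6 := inv f f f
  simp only [hLe, hLw, hLf, map_add, map_smul, add_apply, LinearMap.add_apply,
    LinearMap.smul_apply, smul_apply, smul_eq_mul, kwe, kfe, kfw, kewe, kefe, kefw, kwwe, kwfe,
    kwfw, kffe, kffw] at p1 p2 p3 p4 p5 p6
  subst e1
  -- Components vanish in order of increasing weight, where `e, w, f` count 0, 1, 2. In weights 2, 3
  -- and 4 two components remain; invariance and tracelessness give independent relations between
  -- them. Only the component on `f, f, f` escapes.
  have z1 : h (K e e) e = 0 := by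
    have : ρ * p * h (K e e) e = 0 := by linear_combination -p1
    simpa [hww, hp] using this
  rw [z1] at p2 p3 p4 p5 p6
  have z2 : h (K e e) w = 0 := by
    have : p * h (K e e) w = 0 := by linear_combination p2
    simpa [hp] using this
  rw [z2] at p3 p4 p5 p6
  have a3 : h (K e w) w = ρ * h (K e e) f := by
    have : p * (h (K e w) w - ρ * h (K e e) f) = 0 := by linear_combination p3
    exact sub_eq_zero.1 ((mul_eq_zero.1 this).resolve_left hp)
  have z3 : h (K e e) f = 0 := by
    have : ρ * h (K e e) f = 0 := by linarith
    simpa [hww] using this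
  have z4 : h (K e w) w = 0 := by rw [a3, z3, mul_zero]
  rw [z3, z4] at p4 p5 p6
  have a5 : h (K w w) w = 2 * (ρ * h (K e w) f) := by
    have : p * (h (K w w) w - 2 * (ρ * h (K e w) f)) = 0 := by linear_combination p4
    exact sub_eq_zero.1 ((mul_eq_zero.1 this).resolve_left hp)
  have z5 : h (K e w) f = 0 := by
    have : ρ * h (K e w) f = 0 := by linarith
    simpa [hww] using this
  have z6 : h (K w w) w = 0 := by rw [a5, z5, mul_zero, mul_zero]
  rw [z5, z6] at p5 p6
  have a7 : 2 * h (K w w) f = ρ * h (K e f) f := by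
    have : p * (2 * h (K w w) f - ρ * h (K e f) f) = 0 := by linear_combination p5
    exact sub_eq_zero.1 ((mul_eq_zero.1 this).resolve_left hp)
  have z7 : h (K e f) f = 0 := by
    have : ρ * h (K e f) f = 0 := by linarith
    simpa [hww] using this
  have z8 : h (K w w) f = 0 := by
    rw [z7] at a7
    linarith
  rw [z7, z8] at p6
  have z9 : h (K w f) f = 0 := by
    have : p * h (K w f) f = 0 := by linear_combination p6 / 3
    simpa [hp] using this
  have zero : ∀ U, h U f = 0 → h U w = 0 → h U e = 0 → U = 0 := fun U h1 h2 h3 => by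
    rw [expand U, h1, h2, h3]
    simp
  have Kee : K e e = 0 := zero _ z3 z2 z1
  have Kew : K e w = 0 := zero _ z5 z4 (by rw [kewe, z2])
  have Kef : K e f = 0 := zero _ z7 (by rw [kefw, z5]) (by rw [kefe, z3])
  have Kww : K w w = 0 := zero _ z8 z6 (by rw [kwwe, z4])
  have Kwf : K w f = 0 := zero _ z9 (by rw [kwfw, z8]) (by rw [kwfe, z5])
  have Kff : K f f = h (K f f) f • e := by
    conv_lhs => rw [expand (K f f), kffw, z9, kffe, z7]
    simp
  refine ⟨h (K f f) f, eq_smul_of_null_frame hF fun i j => ?_⟩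
  fin_cases i <;> fin_cases j <;>
    simp [Kee, Kew, Kef, Kww, Kwf, kwe, kfe, kfw, hee, hew, hef]
  exact Kff

/-- If the stabilizer of a traceless cubic form in the special orthogonal group is isomorphic to
`ℝ`, then it contains a nontrivial element with a nonzero isotropic fixed vector. -/
theorem exists_isotropic_fixed (hs : ∀ X Y, h X Y = h Y X)
    (hn : ∀ X, (∀ Y, h X Y = 0) → X = 0) {C : E3 →ₗ[ℝ] E3 →ₗ[ℝ] E3} (hC : IsTracelessCubic h C)
    (φ : Multiplicative ℝ ≃* ↥(specialOrthogonal h ⊓ tensorStabilizer fun X Y => C X Y)) :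
    ∃ L ∈ specialOrthogonal h ⊓ tensorStabilizer (fun X Y => C X Y), L ≠ 1 ∧
      ∃ e, e ≠ 0 ∧ h e e = 0 ∧ L e = e := by
  have torsion : ∀ (n : ℕ), n ≠ 0 → ∀ L : E3 ≃ₗ[ℝ] E3,
      L ∈ specialOrthogonal h ⊓ tensorStabilizer (fun X Y => C X Y) → L ^ n = 1 → L = 1 := by
    intro n hn0 L hL hLn
    have h1 : φ.symm ⟨L, hL⟩ ^ n = 1 := by
      rw [← map_pow, ← map_one φ.symm]
      exact congrArg _ (Subtype.ext hLn)
    have h2 : φ.symm ⟨L, hL⟩ = 1 := by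
      have h3 := congrArg Multiplicative.toAdd h1
      rw [toAdd_pow, toAdd_one, smul_eq_zero_iff_right hn0] at h3
      exact h3
    have h4 := (MulEquiv.map_eq_one_iff φ.symm).1 h2
    exact congrArg Subtype.val h4
  let g := φ (Multiplicative.ofAdd 1)
  have hg1 : (g : E3 ≃ₗ[ℝ] E3) ≠ 1 := by
    intro h0
    have h1 : g = 1 := Subtype.ext h0
    have h2 := (MulEquiv.map_eq_one_iff φ).1 h1
    exact one_ne_zero (α := ℝ) (Multiplicative.ofAdd.injective h2)
  obtain ⟨v, hv0, hv⟩ := exists_fixed_vector hn g.2.1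
  refine ⟨g, g.2, hg1, v, hv0, ?_, hv⟩
  -- A nonisotropic `v` would put the half turn about `v` into the stabilizer. Being an involution
  -- in a torsion-free group it would be the identity, yet it negates vectors orthogonal to `v`.
  by_contra hvv
  have hR := halfTurn_invariant hs hn hC g.2.1 g.2.2 hvv hv fun h3 =>
    hg1 (torsion 3 (by norm_num) _ g.2 h3)
  have hR1 := torsion 2 (by norm_num)
    (LinearEquiv.ofInvolutive (halfTurn h v) (halfTurn_involutive hvv))
    ⟨halfTurn_mem hs hn hvv, hR⟩ (LinearEquiv.ext fun X => halfTurn_involutive hvv X)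
  obtain ⟨x, y, hvx, -, -, hxx, -⟩ := exists_orthogonal_frame hs hn hvv
  have h1 : halfTurn h v x = x := LinearEquiv.congr_fun hR1 x
  rw [halfTurn_of_orthogonal hvx] at h1
  have h2 := congrArg (fun z => h x z) h1
  simp only [map_neg] at h2
  exact hxx (by linarith)

end CubicForms

/-! ### Derivatives of determinants -/

section Determinant

/-- Jacobi's formula for the derivative of a determinant. -/
theorem hasDerivAt_det {n : Type*} [Fintype n] [DecidableEq n] {M : ℝ → Matrix n n ℝ}
    {M' : Matrix n n ℝ} {t : ℝ} (hM : ∀ i j, HasDerivAt (fun s => M s i j) (M' i j) t) :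
    HasDerivAt (fun s => (M s).det) ((M t).adjugate * M').trace t := by
  have h1 : HasDerivAt (fun s => (M s).det)
      (∑ σ : Equiv.Perm n, ((Equiv.Perm.sign σ : ℤ) : ℝ) *
        ∑ i, (∏ j ∈ Finset.univ.erase i, M t (σ j) j) • M' (σ i) i) t := by
    simp only [Matrix.det_apply']
    refine HasDerivAt.fun_sum fun σ _ => HasDerivAt.const_mul _ ?_
    exact HasDerivAt.fun_finsetProd fun i _ => hM (σ i) i
  convert h1 using 1
  -- Cramer's rule: the trace becomes the sum over columns of the determinants with one column
  -- differentiated.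
  have h2 : ∀ i, ((M t).adjugate * M') i i = ((M t).updateCol i fun k => M' k i).det := by
    intro i
    rw [← Matrix.cramer_apply, Matrix.cramer_eq_adjugate_mulVec]
    rfl
  simp only [Matrix.trace, Matrix.diag_apply, h2, Matrix.det_apply', Finset.mul_sum]
  rw [Finset.sum_comm]
  refine Finset.sum_congr rfl fun σ _ => Finset.sum_congr rfl fun i _ => ?_
  rw [← Finset.mul_prod_erase _ _ (Finset.mem_univ i), Matrix.updateCol_self, smul_eq_mul]
  rw [mul_comm (M' _ _)]
  congr 2
  refine Finset.prod_congr rfl fun j hj => ?_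
  rw [Matrix.updateCol_ne (Finset.ne_of_mem_erase hj)]

/-- If `M' = N M` then `(det M)' = tr N det M`. -/
theorem hasDerivAt_det_of_mul_left {n : Type*} [Fintype n] [DecidableEq n]
    {M : ℝ → Matrix n n ℝ} {N : Matrix n n ℝ} {t : ℝ}
    (hM : ∀ i j, HasDerivAt (fun s => M s i j) ((N * M t) i j) t) :
    HasDerivAt (fun s => (M s).det) (N.trace * (M t).det) t := by
  convert hasDerivAt_det hM using 1
  rw [Matrix.trace_mul_comm, Matrix.mul_assoc, Matrix.mul_adjugate, Matrix.mul_smul,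
    Matrix.mul_one, Matrix.trace_smul, smul_eq_mul, mul_comm]

/-- If `M' = N M + M Nᵀ` then `(det M)' = 2 tr N det M`. -/
theorem hasDerivAt_det_of_congruence {n : Type*} [Fintype n] [DecidableEq n]
    {M : ℝ → Matrix n n ℝ} {N : Matrix n n ℝ} {t : ℝ}
    (hM : ∀ i j, HasDerivAt (fun s => M s i j) ((N * M t + M t * N.transpose) i j) t) :
    HasDerivAt (fun s => (M s).det) (2 * N.trace * (M t).det) t := by
  convert hasDerivAt_det hM using 1
  rw [Matrix.mul_add, Matrix.trace_add, Matrix.trace_mul_comm, Matrix.mul_assoc,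
    Matrix.mul_adjugate, ← Matrix.mul_assoc, Matrix.adjugate_mul, Matrix.mul_smul,
    Matrix.mul_one, Matrix.smul_mul, Matrix.one_mul, Matrix.trace_smul, Matrix.trace_smul,
    Matrix.trace_transpose, smul_eq_mul]
  ring

end Determinant

/-! ### Differentiating bilinear fields; regularity of the Christoffel symbols -/

section Calculus

theorem minSmoothness_two_le : minSmoothness ℝ 2 ≤ (∞ : WithTop ℕ∞) := by
  rw [minSmoothness_of_isRCLikeNormedField]
  exact WithTop.coe_le_coe.2 le_top

variable {F : Type*} [NormedAddCommGroup F] [NormedSpace ℝ F]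

theorem fderiv_apply_apply {A : E3 → E3 →L[ℝ] E3 →L[ℝ] F} {x : E3}
    (hA : DifferentiableAt ℝ A x) (X Y Z : E3) :
    fderiv ℝ (fun y => A y X Y) x Z = fderiv ℝ A x Z X Y := by
  rw [fderiv_clm_apply (by fun_prop) (by fun_prop), fderiv_clm_apply hA (by fun_prop)]
  simp

end Calculus

section LeviCivita

variable {g : E3 → E3 →L[ℝ] E3 →L[ℝ] ℝ} {x : E3}

theorem isInvertible_of_nondegenerate {B : E3 →L[ℝ] E3 →L[ℝ] ℝ}
    (hn : ∀ X, (∀ Y, B X Y = 0) → X = 0) : B.IsInvertible := by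
  have hinj : Function.Injective B := by
    rw [injective_iff_map_eq_zero]
    exact fun X hX => hn X fun Y => by rw [hX]; rfl
  have hfin : Module.finrank ℝ E3 = Module.finrank ℝ (E3 →L[ℝ] ℝ) := by
    rw [← LinearMap.toContinuousLinearMap.finrank_eq]
    exact Subspace.dual_finrank_eq.symm
  have : FiniteDimensional ℝ (E3 →L[ℝ] ℝ) :=
    LinearMap.toContinuousLinearMap.finiteDimensional
  refine ⟨(LinearEquiv.ofInjectiveOfFinrankEq (B : E3 →ₗ[ℝ] E3 →L[ℝ] ℝ) hinj
    hfin).toContinuousLinearEquiv, ?_⟩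
  ext X Y
  rfl

theorem apply_leviCivita (hn : ∀ X, (∀ Y, g x X Y = 0) → X = 0) (X Y Z : E3) :
    g x (leviCivita g x X Y) Z
      = (fderiv ℝ g x X Y Z + fderiv ℝ g x Y X Z - fderiv ℝ g x Z X Y) / 2 := by
  rw [leviCivita, (isInvertible_of_nondegenerate hn).self_apply_inverse]
  simp [christoffelFirst]
  ring

set_option maxSynthPendingDepth 6 in
theorem differentiableAt_christoffelFirst (hg : DifferentiableAt ℝ (fderiv ℝ g) x) (X Y : E3) :
    DifferentiableAt ℝ (fun y => christoffelFirst g y X Y) x := by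
  have h1 : DifferentiableAt ℝ (fun y => fderiv ℝ g y X) x := hg.clm_apply (by fun_prop)
  have h2 : DifferentiableAt ℝ (fun y => fderiv ℝ g y Y) x := hg.clm_apply (by fun_prop)
  have h3 : DifferentiableAt ℝ (fun y => (fderiv ℝ g y).flip X) x :=
    (ContinuousLinearMap.flipₗᵢ ℝ E3 E3 (E3 →L[ℝ] ℝ)).toContinuousLinearEquiv.differentiableAt.comp
      x hg |>.clm_apply (differentiableAt_const X)
  have h4 : DifferentiableAt ℝ (fun y => ((fderiv ℝ g y).flip X).flip Y) x :=
    (ContinuousLinearMap.flipₗᵢ ℝ E3 E3 ℝ).toContinuousLinearEquiv.differentiableAt.comp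
      x h3 |>.clm_apply (differentiableAt_const Y)
  have h5 : DifferentiableAt ℝ (fun y => fderiv ℝ g y X Y) x := h1.clm_apply (by fun_prop)
  have h6 : DifferentiableAt ℝ (fun y => fderiv ℝ g y Y X) x := h2.clm_apply (by fun_prop)
  exact ((h5.add h6).sub h4).const_smul (1 / 2 : ℝ)

set_option maxSynthPendingDepth 6 in
theorem differentiableAt_leviCivita (hg : ContDiffAt ℝ ∞ g x)
    (hn : ∀ X, (∀ Y, g x X Y = 0) → X = 0) (X Y : E3) :
    DifferentiableAt ℝ (fun y => leviCivita g y X Y) x := by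
  have h1 : ContDiffAt ℝ ∞ (fun y => (g y).inverse) x :=
    ((isInvertible_of_nondegenerate hn).contDiffAt_map_inverse (n := ∞)).comp x hg
  have h2 : ContDiffAt ℝ ∞ (fderiv ℝ g) x := hg.fderiv_right (by simp)
  exact (h1.differentiableAt (by simp)).clm_apply
    (differentiableAt_christoffelFirst (h2.differentiableAt (by simp)) X Y)

end LeviCivita

/-! ### Hyperspheres in a coordinate domain -/

/-- `f` is a hypersphere with affine normal `ξ` and shape operator `H` times the identity in the
open coordinate domain `U`. -/
structure IsLocalHypersphere (U : Set E3) (f ξ : E3 → E4) (H : ℝ) : Prop where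
  isOpen : IsOpen U
  smooth : ContDiffOn ℝ ∞ f U
  smooth_normal : ContDiffOn ℝ ∞ ξ U
  blaschke : ∀ x ∈ U, IsBlaschkeNormalAt f ξ x
  shape : ∀ x ∈ U, ∀ X, shapeOperator f ξ x X = H • X

namespace IsLocalHypersphere

variable {U : Set E3} {f ξ : E3 → E4} {H : ℝ} {x : E3}

theorem contDiffAt (hM : IsLocalHypersphere U f ξ H) (hx : x ∈ U) : ContDiffAt ℝ ∞ f x :=
  hM.smooth.contDiffAt (hM.isOpen.mem_nhds hx)

theorem contDiffAt_normal (hM : IsLocalHypersphere U f ξ H) (hx : x ∈ U) : ContDiffAt ℝ ∞ ξ x :=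
  hM.smooth_normal.contDiffAt (hM.isOpen.mem_nhds hx)

theorem contDiffAt_fderiv (hM : IsLocalHypersphere U f ξ H) (hx : x ∈ U) :
    ContDiffAt ℝ ∞ (fderiv ℝ f) x :=
  (hM.contDiffAt hx).fderiv_right (by simp)

theorem contDiffAt_hessian (hM : IsLocalHypersphere U f ξ H) (hx : x ∈ U) :
    ContDiffAt ℝ ∞ (fderiv ℝ (fderiv ℝ f)) x :=
  (hM.contDiffAt_fderiv hx).fderiv_right (by simp)

theorem isInvertible_frameMap (hM : IsLocalHypersphere U f ξ H) (hx : x ∈ U) :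
    (frameMap f ξ x).IsInvertible := by
  by_contra hcon
  -- The inverse of a noninvertible map is 0 by convention, which would make the affine metric zero.
  have h0 := (hM.blaschke x hx).nondegenerate (coordVec 0) fun Y => by
    simp [affineMetric, transversalPart, ContinuousLinearMap.inverse_of_not_isInvertible hcon]
  have := congrArg (fun u : E3 => u 0) h0
  simp [coordVec] at this

theorem frameMap_apply (X : E3) (a : ℝ) :
    frameMap f ξ x (X, a) = fderiv ℝ f x X + a • ξ x := by
  simp [frameMap]

theorem frame_injective (hM : IsLocalHypersphere U f ξ H) (hx : x ∈ U) {X Y : E3} {a b : ℝ}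
    (hXY : fderiv ℝ f x X + a • ξ x = fderiv ℝ f x Y + b • ξ x) : X = Y ∧ a = b := by
  rw [← frameMap_apply, ← frameMap_apply] at hXY
  exact Prod.ext_iff.1 ((hM.isInvertible_frameMap hx).injective hXY)

theorem decompose (hM : IsLocalHypersphere U f ξ H) (hx : x ∈ U) (v : E4) :
    v = fderiv ℝ f x (tangentialPart f ξ x v) + transversalPart f ξ x v • ξ x := by
  rw [← frameMap_apply]
  exact ((hM.isInvertible_frameMap hx).self_apply_inverse v).symm

theorem gauss_formula (hM : IsLocalHypersphere U f ξ H) (hx : x ∈ U) (X Y : E3) :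
    fderiv ℝ (fderiv ℝ f) x X Y = fderiv ℝ f x (inducedConnection f ξ x X Y)
      + affineMetric f ξ x X Y • ξ x :=
  hM.decompose hx _

theorem weingarten_formula (hM : IsLocalHypersphere U f ξ H) (hx : x ∈ U) (X : E3) :
    fderiv ℝ ξ x X = fderiv ℝ f x (-(H • X)) := by
  have h1 := hM.decompose hx (fderiv ℝ ξ x X)
  have h2 : tangentialPart f ξ x (fderiv ℝ ξ x X) = -(H • X) := by
    rw [← hM.shape x hx X]
    simp [shapeOperator]
  obtain ⟨Y, hY⟩ := (hM.blaschke x hx).tangential X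
  have h3 := (hM.frame_injective hx (X := Y) (a := 0)
    (Y := tangentialPart f ξ x (fderiv ℝ ξ x X)) (b := transversalPart f ξ x (fderiv ℝ ξ x X))
    (by rw [hY, zero_smul, add_zero, ← h1])).2
  rw [h2, ← h3, zero_smul, add_zero] at h1
  exact h1

theorem contDiffAt_inverse_frameMap (hM : IsLocalHypersphere U f ξ H) (hx : x ∈ U) :
    ContDiffAt ℝ ∞ (fun y => (frameMap f ξ y).inverse) x := by
  have h1 : ContDiffAt ℝ ∞ (frameMap f ξ) x := by
    have e : frameMap f ξ = fun y => (fderiv ℝ f y).comp (ContinuousLinearMap.fst ℝ E3 ℝ)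
        + (ContinuousLinearMap.snd ℝ E3 ℝ).smulRight (ξ y) := by
      ext y v
      all_goals simp [frameMap]
    rw [e]
    exact ((hM.contDiffAt_fderiv hx).clm_comp contDiffAt_const).add
      (contDiffAt_const.smulRight (hM.contDiffAt_normal hx))
  exact ((hM.isInvertible_frameMap hx).contDiffAt_map_inverse (n := ∞)).comp x h1

theorem contDiffAt_inducedConnection (hM : IsLocalHypersphere U f ξ H) (hx : x ∈ U) :
    ContDiffAt ℝ ∞ (inducedConnection f ξ) x := by
  have h1 : ContDiffAt ℝ ∞ (tangentialPart f ξ) x :=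
    contDiffAt_const.clm_comp (hM.contDiffAt_inverse_frameMap hx)
  have h2 : ContDiffAt ℝ ∞ (fun y => ContinuousLinearMap.compL ℝ E3 E4 E3
      (tangentialPart f ξ y)) x := ContDiffAt.clm_apply contDiffAt_const h1
  exact ContDiffAt.clm_comp h2 (hM.contDiffAt_hessian hx)

theorem contDiffAt_affineMetric (hM : IsLocalHypersphere U f ξ H) (hx : x ∈ U) :
    ContDiffAt ℝ ∞ (affineMetric f ξ) x := by
  have h1 : ContDiffAt ℝ ∞ (transversalPart f ξ) x :=
    contDiffAt_const.clm_comp (hM.contDiffAt_inverse_frameMap hx)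
  have h2 : ContDiffAt ℝ ∞ (fun y => ContinuousLinearMap.compL ℝ E3 E4 ℝ
      (transversalPart f ξ y)) x := ContDiffAt.clm_apply contDiffAt_const h1
  exact ContDiffAt.clm_comp h2 (hM.contDiffAt_hessian hx)

theorem hessian_symm (hM : IsLocalHypersphere U f ξ H) (hx : x ∈ U) (X Y : E3) :
    fderiv ℝ (fderiv ℝ f) x X Y = fderiv ℝ (fderiv ℝ f) x Y X :=
  (hM.contDiffAt hx).isSymmSndFDerivAt minSmoothness_two_le X Y

theorem inducedConnection_symm (hM : IsLocalHypersphere U f ξ H) (hx : x ∈ U) (X Y : E3) :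
    inducedConnection f ξ x X Y = inducedConnection f ξ x Y X :=
  congrArg (tangentialPart f ξ x) (hM.hessian_symm hx X Y)

theorem affineMetric_symm (hM : IsLocalHypersphere U f ξ H) (hx : x ∈ U) (X Y : E3) :
    affineMetric f ξ x X Y = affineMetric f ξ x Y X :=
  congrArg (transversalPart f ξ x) (hM.hessian_symm hx X Y)

theorem fderiv_affineMetric_symm (hM : IsLocalHypersphere U f ξ H) (hx : x ∈ U) (X Y Z : E3) :
    fderiv ℝ (affineMetric f ξ) x X Y Z = fderiv ℝ (affineMetric f ξ) x X Z Y := by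
  have hd := (hM.contDiffAt_affineMetric hx).differentiableAt (by simp)
  rw [← fderiv_apply_apply hd, ← fderiv_apply_apply hd]
  congr 1
  refine Filter.EventuallyEq.fderiv_eq ?_
  filter_upwards [hM.isOpen.mem_nhds hx] with y hy
  exact hM.affineMetric_symm hy Y Z

/-- Differentiate the Gauss formula and substitute the Gauss and Weingarten formulas again. The
symmetry of the left side in `X` and `Z` then yields the Gauss equation tangentially and the Codazzi
equation transversally. -/
theorem third_derivative (hM : IsLocalHypersphere U f ξ H) (hx : x ∈ U) (X Y Z : E3) :
    fderiv ℝ (fderiv ℝ (fderiv ℝ f)) x Z X Y =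
      fderiv ℝ f x (fderiv ℝ (inducedConnection f ξ) x Z X Y
        + inducedConnection f ξ x Z (inducedConnection f ξ x X Y)
        - (H * affineMetric f ξ x X Y) • Z)
      + (fderiv ℝ (affineMetric f ξ) x Z X Y
        + affineMetric f ξ x Z (inducedConnection f ξ x X Y)) • ξ x := by
  have d1 := (hM.contDiffAt_hessian hx).differentiableAt (by simp)
  have d2 := (hM.contDiffAt_inducedConnection hx).differentiableAt (by simp)
  have d3 := (hM.contDiffAt_affineMetric hx).differentiableAt (by simp)
  have d4 := (hM.contDiffAt_fderiv hx).differentiableAt (by simp)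
  have d5 := (hM.contDiffAt_normal hx).differentiableAt (by simp)
  have e : (fun y => fderiv ℝ (fderiv ℝ f) y X Y) =ᶠ[nhds x] fun y =>
      fderiv ℝ f y (inducedConnection f ξ y X Y) + affineMetric f ξ y X Y • ξ y := by
    filter_upwards [hM.isOpen.mem_nhds hx] with y hy
    exact hM.gauss_formula hy X Y
  have d6 : DifferentiableAt ℝ (fun y => inducedConnection f ξ y X Y) x := by fun_prop
  have d7 : DifferentiableAt ℝ (fun y => affineMetric f ξ y X Y) x := by fun_prop
  have e2 := congrArg (fun A : E3 →L[ℝ] E4 => A Z) e.fderiv_eq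
  rw [fderiv_apply_apply d1, fderiv_fun_add (d4.clm_apply d6) (d7.fun_smul d5),
    fderiv_clm_apply d4 d6, fderiv_fun_smul d7 d5] at e2
  simp only [add_apply, ContinuousLinearMap.comp_apply, ContinuousLinearMap.flip_apply,
    smul_apply, ContinuousLinearMap.smulRight_apply, fderiv_apply_apply d2,
    fderiv_apply_apply d3, hM.weingarten_formula hx, hM.gauss_formula hx Z] at e2
  rw [e2]
  simp only [map_add, map_sub, map_neg, map_smul]
  module

/-- The Gauss equation and the Codazzi equation of the affine metric. -/
theorem gauss_codazzi (hM : IsLocalHypersphere U f ξ H) (hx : x ∈ U) (X Y Z : E3) :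
    fderiv ℝ (inducedConnection f ξ) x Z X Y
        + inducedConnection f ξ x Z (inducedConnection f ξ x X Y)
        - (H * affineMetric f ξ x X Y) • Z
      = fderiv ℝ (inducedConnection f ξ) x X Z Y
        + inducedConnection f ξ x X (inducedConnection f ξ x Z Y)
        - (H * affineMetric f ξ x Z Y) • X ∧
    fderiv ℝ (affineMetric f ξ) x Z X Y
        + affineMetric f ξ x Z (inducedConnection f ξ x X Y)
      = fderiv ℝ (affineMetric f ξ) x X Z Y
        + affineMetric f ξ x X (inducedConnection f ξ x Z Y) := by
  refine hM.frame_injective hx ?_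
  rw [← hM.third_derivative hx, ← hM.third_derivative hx]
  exact congrArg (fun A : E3 →L[ℝ] E4 => A Y)
    ((hM.contDiffAt_fderiv hx).isSymmSndFDerivAt minSmoothness_two_le Z X)

end IsLocalHypersphere

/-! ### Conjugate connections and the symmetry of the difference tensor -/

section LeviCivita

variable (g : E3 → E3 →L[ℝ] E3 →L[ℝ] ℝ) (x : E3)

/-- The Christoffel symbols of the Levi-Civita connection as a bilinear map. -/
def leviCivitaLinear : E3 →ₗ[ℝ] E3 →ₗ[ℝ] E3 :=
  LinearMap.mk₂ ℝ (leviCivita g x)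
    (fun X X' Y => by
      rw [leviCivita, leviCivita, leviCivita, ← map_add]
      congr 1
      ext Z
      simp [christoffelFirst]
      ring)
    (fun c X Y => by
      rw [leviCivita, leviCivita, ← map_smul]
      congr 1
      ext Z
      simp [christoffelFirst]
      ring)
    (fun X Y Y' => by
      rw [leviCivita, leviCivita, leviCivita, ← map_add]
      congr 1
      ext Z
      simp [christoffelFirst]
      ring)
    (fun c X Y => by
      rw [leviCivita, leviCivita, ← map_smul]
      congr 1
      ext Z
      simp [christoffelFirst]
      ring)

end LeviCivita

/-- The difference tensor as a bilinear map. -/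
def differenceTensorLinear (f ξ : E3 → E4) (x : E3) : E3 →ₗ[ℝ] E3 →ₗ[ℝ] E3 :=
  LinearMap.mk₂ ℝ (fun X Y => inducedConnection f ξ x X Y)
    (by simp) (by simp) (by simp) (by simp) - leviCivitaLinear (affineMetric f ξ) x

/-- The conjugate connection `2 ∇̂ - ∇`. -/
def conjugateConnection (f ξ : E3 → E4) (x X Y : E3) : E3 :=
  (2 : ℝ) • leviCivita (affineMetric f ξ) x X Y - inducedConnection f ξ x X Y

namespace IsLocalHypersphere

variable {U : Set E3} {f ξ : E3 → E4} {H : ℝ} {x : E3}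

theorem apply_leviCivita (hM : IsLocalHypersphere U f ξ H) (hx : x ∈ U) (X Y Z : E3) :
    affineMetric f ξ x (leviCivita (affineMetric f ξ) x X Y) Z
      = (fderiv ℝ (affineMetric f ξ) x X Y Z + fderiv ℝ (affineMetric f ξ) x Y X Z
        - fderiv ℝ (affineMetric f ξ) x Z X Y) / 2 :=
  AffineGeometry.apply_leviCivita (hM.blaschke x hx).nondegenerate X Y Z

theorem metric_compatible (hM : IsLocalHypersphere U f ξ H) (hx : x ∈ U) (X Y Z : E3) :
    fderiv ℝ (affineMetric f ξ) x X Y Z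
      = affineMetric f ξ x (leviCivita (affineMetric f ξ) x X Y) Z
        + affineMetric f ξ x Y (leviCivita (affineMetric f ξ) x X Z) := by
  rw [hM.affineMetric_symm hx Y, hM.apply_leviCivita hx, hM.apply_leviCivita hx,
    hM.fderiv_affineMetric_symm hx X Z Y, hM.fderiv_affineMetric_symm hx Z X Y,
    hM.fderiv_affineMetric_symm hx Y X Z]
  ring

/-- Duality of the two connections with respect to `h`. It follows from the Codazzi equation and the
Koszul formula. -/
theorem conjugate_compatible (hM : IsLocalHypersphere U f ξ H) (hx : x ∈ U) (X Y Z : E3) :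
    fderiv ℝ (affineMetric f ξ) x X Y Z
      = affineMetric f ξ x (inducedConnection f ξ x X Y) Z
        + affineMetric f ξ x Y (conjugateConnection f ξ x X Z) := by
  have h1 := (hM.gauss_codazzi hx Y X Z).2
  have h2 := hM.apply_leviCivita hx X Z Y
  rw [conjugateConnection, map_sub, map_smul, smul_eq_mul, hM.affineMetric_symm hx Y, h2,
    hM.fderiv_affineMetric_symm hx X Z Y, hM.affineMetric_symm hx _ Z,
    hM.inducedConnection_symm hx X Y]
  rw [hM.fderiv_affineMetric_symm hx Z Y X, hM.inducedConnection_symm hx Z X,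
    hM.fderiv_affineMetric_symm hx Y Z X] at h1
  linarith

/-- Subtracting metric compatibility from the duality of the conjugate connections says that
`K(X,·)` is self-adjoint. -/
theorem isTracelessCubic_symm' (hM : IsLocalHypersphere U f ξ H) (hx : x ∈ U) (X Y Z : E3) :
    affineMetric f ξ x (differenceTensor f ξ x X Y) Z
      = affineMetric f ξ x (differenceTensor f ξ x X Z) Y := by
  have h1 := hM.metric_compatible hx X Y Z
  have h2 := hM.conjugate_compatible hx X Y Z
  rw [conjugateConnection, map_sub, map_smul, smul_eq_mul] at h2
  simp only [differenceTensor, map_sub, sub_apply]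
  rw [hM.affineMetric_symm hx _ Y, hM.affineMetric_symm hx _ Y]
  linarith

theorem differenceTensor_symm (hM : IsLocalHypersphere U f ξ H) (hx : x ∈ U) (X Y : E3) :
    differenceTensor f ξ x X Y = differenceTensor f ξ x Y X := by
  rw [differenceTensor, differenceTensor, hM.inducedConnection_symm hx X Y]
  congr 1
  rw [leviCivita, leviCivita]
  congr 1
  ext Z
  simp [christoffelFirst, hM.fderiv_affineMetric_symm hx Z X Y]
  ring

/-! ### Apolarity from the volume condition -/

theorem det_gram_ne_zero (hM : IsLocalHypersphere U f ξ H) (hx : x ∈ U) :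
    (Matrix.of fun i j => affineMetric f ξ x (coordVec i) (coordVec j)).det ≠ 0 :=
  AffineGeometry.det_gram_ne_zero (hM.blaschke x hx).nondegenerate

theorem trace_eq_sum (T : E3 →ₗ[ℝ] E3) : LinearMap.trace ℝ E3 T = ∑ i, T (coordVec i) i := by
  rw [LinearMap.trace_eq_matrix_trace ℝ (EuclideanSpace.basisFun (Fin 3) ℝ).toBasis]
  simp [Matrix.trace, LinearMap.toMatrix_apply, coordVec]

/-- The volume form `det(df X₀, df X₁, df X₂, ξ)` in the coordinate basis, as a matrix. -/
def volumeMatrix (f ξ : E3 → E4) (x : E3) : Matrix (Fin 4) (Fin 4) ℝ :=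
  Matrix.of fun i j => (![fderiv ℝ f x (coordVec 0), fderiv ℝ f x (coordVec 1),
    fderiv ℝ f x (coordVec 2), ξ x] i) j

theorem hasDerivAt_volume (hM : IsLocalHypersphere U f ξ H) (hx : x ∈ U) (X : E3) :
    HasDerivAt (fun t : ℝ => (volumeMatrix f ξ (x + t • X)).det)
      ((∑ i, inducedConnection f ξ x X (coordVec i) i) * (volumeMatrix f ξ x).det) 0 := by
  have d4 := (hM.contDiffAt_fderiv hx).differentiableAt (by simp)
  have d5 := (hM.contDiffAt_normal hx).differentiableAt (by simp)
  let Γ := fun i k => inducedConnection f ξ x X (coordVec i) k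
  let η := fun i => affineMetric f ξ x X (coordVec i)
  -- The rows are the Gauss formula for the three tangent vectors and the Weingarten formula for
  -- `ξ`. The last diagonal entry is 0 because `Dξ` is tangential, so the trace is that of the
  -- induced connection.
  let N : Matrix (Fin 4) (Fin 4) ℝ :=
    !![Γ 0 0, Γ 0 1, Γ 0 2, η 0; Γ 1 0, Γ 1 1, Γ 1 2, η 1; Γ 2 0, Γ 2 1, Γ 2 2, η 2;
      -(H * X 0), -(H * X 1), -(H * X 2), 0]
  have expand : ∀ V : E3, fderiv ℝ f x V = V 0 • fderiv ℝ f x (coordVec 0)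
      + V 1 • fderiv ℝ f x (coordVec 1) + V 2 • fderiv ℝ f x (coordVec 2) := fun V => by
    conv_lhs => rw [← sum_smul_coordVec V]
    simp [Fin.sum_univ_three]
  have h1 : ∀ (i : Fin 3) (j : Fin 4), HasDerivAt
      (fun t : ℝ => (fderiv ℝ f (x + t • X) (coordVec i)) j)
      (Γ i 0 * fderiv ℝ f x (coordVec 0) j + Γ i 1 * fderiv ℝ f x (coordVec 1) j
        + Γ i 2 * fderiv ℝ f x (coordVec 2) j + η i * ξ x j) 0 := by
    intro i j
    have d6 : DifferentiableAt ℝ (fun y => fderiv ℝ f y (coordVec i)) x := by fun_prop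
    have h2 : HasDerivAt (fun t : ℝ => fderiv ℝ f (x + t • X) (coordVec i))
        (fderiv ℝ (fun y => fderiv ℝ f y (coordVec i)) x X) 0 := d6.hasFDerivAt.hasLineDerivAt X
    rw [fderiv_clm_apply d4 (by fun_prop)] at h2
    have h3 := (EuclideanSpace.proj (𝕜 := ℝ) j).hasFDerivAt.comp_hasDerivAt 0 h2
    refine h3.congr_deriv ?_
    simp [hM.gauss_formula hx, expand (inducedConnection f ξ x X (coordVec i)), Γ, η]
  have h4 : ∀ j : Fin 4, HasDerivAt (fun t : ℝ => (ξ (x + t • X)) j)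
      (-(H * X 0) * fderiv ℝ f x (coordVec 0) j + -(H * X 1) * fderiv ℝ f x (coordVec 1) j
        + -(H * X 2) * fderiv ℝ f x (coordVec 2) j + 0 * ξ x j) 0 := by
    intro j
    have h2 : HasDerivAt (fun t : ℝ => ξ (x + t • X)) (fderiv ℝ ξ x X) 0 :=
      d5.hasFDerivAt.hasLineDerivAt X
    have h3 := (EuclideanSpace.proj (𝕜 := ℝ) j).hasFDerivAt.comp_hasDerivAt 0 h2
    refine h3.congr_deriv ?_
    simp [hM.weingarten_formula hx, expand (-(H • X))]
  have h5 := hasDerivAt_det_of_mul_left (M := fun t => volumeMatrix f ξ (x + t • X)) (N := N)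
    (t := 0) (fun i j => by
      fin_cases i
      · refine (h1 0 j).congr_deriv ?_
        simp [Matrix.mul_apply, Fin.sum_univ_four, N, volumeMatrix]
      · refine (h1 1 j).congr_deriv ?_
        simp [Matrix.mul_apply, Fin.sum_univ_four, N, volumeMatrix]
      · refine (h1 2 j).congr_deriv ?_
        simp [Matrix.mul_apply, Fin.sum_univ_four, N, volumeMatrix]
      · refine (h4 j).congr_deriv ?_
        simp [Matrix.mul_apply, Fin.sum_univ_four, N, volumeMatrix])
  refine h5.congr_deriv ?_
  simp [Matrix.trace, Fin.sum_univ_four, Fin.sum_univ_three, N, Γ]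

theorem hasDerivAt_gram (hM : IsLocalHypersphere U f ξ H) (hx : x ∈ U) (X : E3) :
    HasDerivAt (fun t : ℝ => (Matrix.of fun i j =>
        affineMetric f ξ (x + t • X) (coordVec i) (coordVec j)).det)
      (2 * (∑ i, leviCivita (affineMetric f ξ) x X (coordVec i) i) *
        (Matrix.of fun i j => affineMetric f ξ x (coordVec i) (coordVec j)).det) 0 := by
  have d3 := (hM.contDiffAt_affineMetric hx).differentiableAt (by simp)
  have h5 := hasDerivAt_det_of_congruence (M := fun t => Matrix.of fun i j =>
      affineMetric f ξ (x + t • X) (coordVec i) (coordVec j))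
    (N := Matrix.of fun i k => leviCivita (affineMetric f ξ) x X (coordVec i) k)
    (t := 0) (fun i j => by
      have d6 : DifferentiableAt ℝ (fun y => affineMetric f ξ y (coordVec i) (coordVec j)) x := by
        fun_prop
      have h2 : HasDerivAt (fun t : ℝ => affineMetric f ξ (x + t • X) (coordVec i) (coordVec j))
        (fderiv ℝ (fun y => affineMetric f ξ y (coordVec i) (coordVec j)) x X) 0 :=
          d6.hasFDerivAt.hasLineDerivAt X
      refine h2.congr_deriv ?_
      rw [fderiv_apply_apply d3, hM.metric_compatible hx]
      conv_lhs =>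
        rw [← sum_smul_coordVec (leviCivita (affineMetric f ξ) x X (coordVec i)),
          ← sum_smul_coordVec (leviCivita (affineMetric f ξ) x X (coordVec j))]
      simp [Matrix.mul_apply, mul_comm])
  refine h5.congr_deriv ?_
  simp [Matrix.trace]

/-- Apolarity: the difference tensor is traceless. -/
theorem trace_differenceTensor (hM : IsLocalHypersphere U f ξ H) (hx : x ∈ U) (X : E3) :
    ∑ i, differenceTensor f ξ x X (coordVec i) i = 0 := by
  have h1 := hM.hasDerivAt_volume hx X
  have h2 := hM.hasDerivAt_gram hx X
  -- Squaring the volume condition removes the absolute value. The logarithmic derivatives of the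
  -- two sides are four times the traces of the induced and the Levi-Civita connection.
  have key : ∀ y ∈ U, (volumeMatrix f ξ y).det ^ 4
      = (Matrix.of fun i j => affineMetric f ξ y (coordVec i) (coordVec j)).det ^ 2 := by
    intro y hy
    have h0 : (volumeMatrix f ξ y).det ^ 2
        = |(Matrix.of fun i j => affineMetric f ξ y (coordVec i) (coordVec j)).det| :=
      (hM.blaschke y hy).volume coordVec
    rw [← sq_abs (Matrix.det (Matrix.of fun i j => _)), ← h0]
    ring
  have hnhds : ∀ᶠ t : ℝ in nhds 0, x + t • X ∈ U := by
    have hc : Filter.Tendsto (fun t : ℝ => x + t • X) (nhds 0) (nhds x) := by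
      have : ContinuousAt (fun t : ℝ => x + t • X) 0 := by fun_prop
      simpa [ContinuousAt] using this
    exact hc.eventually (hM.isOpen.mem_nhds hx)
  have h3 := (h1.pow 4).congr_of_eventuallyEq (f₁ := fun t : ℝ => (Matrix.of fun i j =>
        affineMetric f ξ (x + t • X) (coordVec i) (coordVec j)).det ^ 2)
    (hnhds.mono fun t ht => (key _ ht).symm)
  have h4 := h3.unique (h2.pow 2)
  have h5 := key x hx
  have h6 := hM.det_gram_ne_zero hx
  simp only [zero_smul, add_zero] at h4
  simp only [differenceTensor, PiLp.sub_apply, Finset.sum_sub_distrib]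
  generalize (volumeMatrix f ξ x).det = θ at *
  generalize (Matrix.of fun i j => affineMetric f ξ x (coordVec i) (coordVec j)).det = D at *
  generalize ∑ i, inducedConnection f ξ x X (coordVec i) i = a at *
  generalize ∑ i, leviCivita (affineMetric f ξ) x X (coordVec i) i = b at *
  have h7 : D ^ 2 * (a - b) = 0 := by
    norm_num at h4
    linear_combination h4 / 4 - a * h5
  exact (mul_eq_zero.1 h7).resolve_left (pow_ne_zero 2 h6)

theorem isTracelessCubic (hM : IsLocalHypersphere U f ξ H) (hx : x ∈ U) :
    IsTracelessCubic (affineMetric f ξ x) (differenceTensorLinear f ξ x) where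
  symm X Y := hM.differenceTensor_symm hx X Y
  symm' X Y Z := hM.isTracelessCubic_symm' hx X Y Z
  trace X := by
    rw [trace_eq_sum]
    exact hM.trace_differenceTensor hx X

end IsLocalHypersphere

/-! ### Curvature of the affine metric -/

namespace IsLocalHypersphere

variable {U : Set E3} {f ξ : E3 → E4} {H : ℝ} {x : E3}

theorem differentiableAt_leviCivita (hM : IsLocalHypersphere U f ξ H) (hx : x ∈ U) (X Y : E3) :
    DifferentiableAt ℝ (fun y => leviCivita (affineMetric f ξ) y X Y) x :=
  AffineGeometry.differentiableAt_leviCivita (hM.contDiffAt_affineMetric hx)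
    (hM.blaschke x hx).nondegenerate X Y

theorem differentiableAt_conjugateConnection (hM : IsLocalHypersphere U f ξ H) (hx : x ∈ U)
    (X Y : E3) : DifferentiableAt ℝ (fun y => conjugateConnection f ξ y X Y) x := by
  have d1 := hM.differentiableAt_leviCivita hx X Y
  have d2 := (hM.contDiffAt_inducedConnection hx).differentiableAt (by simp)
  unfold conjugateConnection
  fun_prop

set_option maxSynthPendingDepth 6 in
/-- The derivative of the compatibility of the conjugate connections. -/
theorem second_derivative_affineMetric (hM : IsLocalHypersphere U f ξ H) (hx : x ∈ U)
    (W X Y Z : E3) :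
    fderiv ℝ (fderiv ℝ (affineMetric f ξ)) x W X Y Z
      = affineMetric f ξ x (fderiv ℝ (inducedConnection f ξ) x W X Y
          + inducedConnection f ξ x W (inducedConnection f ξ x X Y)) Z
        + affineMetric f ξ x (inducedConnection f ξ x X Y) (conjugateConnection f ξ x W Z)
        + affineMetric f ξ x (inducedConnection f ξ x W Y) (conjugateConnection f ξ x X Z)
        + affineMetric f ξ x Y (fderiv ℝ (fun y => conjugateConnection f ξ y X Z) x W
          + conjugateConnection f ξ x W (conjugateConnection f ξ x X Z)) := by
  have d1 := (hM.contDiffAt_affineMetric hx).differentiableAt (by simp)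
  have d2 := (hM.contDiffAt_inducedConnection hx).differentiableAt (by simp)
  have d3 := hM.differentiableAt_conjugateConnection hx X Z
  have d4 : DifferentiableAt ℝ (fderiv ℝ (affineMetric f ξ)) x :=
    ((hM.contDiffAt_affineMetric hx).fderiv_right (m := ∞) (by simp)).differentiableAt (by simp)
  have e : (fun y => fderiv ℝ (affineMetric f ξ) y X Y Z) =ᶠ[nhds x] fun y =>
      affineMetric f ξ y (inducedConnection f ξ y X Y) Z
        + affineMetric f ξ y Y (conjugateConnection f ξ y X Z) := by
    filter_upwards [hM.isOpen.mem_nhds hx] with y hy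
    exact hM.conjugate_compatible hy X Y Z
  have d5 : DifferentiableAt ℝ (fun y => inducedConnection f ξ y X Y) x := by fun_prop
  have d6 : DifferentiableAt ℝ (fun y => affineMetric f ξ y (inducedConnection f ξ y X Y)) x :=
    d1.clm_apply d5
  have d7 : DifferentiableAt ℝ (fun y => affineMetric f ξ y Y) x := by fun_prop
  have d8 : DifferentiableAt ℝ (fun y => fderiv ℝ (affineMetric f ξ) y X) x :=
    d4.clm_apply (differentiableAt_const X)
  have d9 : DifferentiableAt ℝ (fun y => fderiv ℝ (affineMetric f ξ) y X Y) x :=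
    d8.clm_apply (differentiableAt_const Y)
  have e2 := congrArg (fun A : E3 →L[ℝ] ℝ => A W) e.fderiv_eq
  rw [fderiv_clm_apply d9 (differentiableAt_const Z), fderiv_clm_apply d8 (differentiableAt_const Y),
    fderiv_clm_apply d4 (differentiableAt_const X),
    fderiv_fun_add (d6.clm_apply (differentiableAt_const Z)) (d7.clm_apply d3),
    fderiv_clm_apply d6 (differentiableAt_const Z), fderiv_clm_apply d7 d3,
    fderiv_clm_apply d1 d5, fderiv_clm_apply d1 (differentiableAt_const Y)] at e2
  simp only [add_apply, ContinuousLinearMap.comp_apply, ContinuousLinearMap.flip_apply,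
    fderiv_fun_const, Pi.zero_apply, zero_apply, map_zero, zero_add,
    fderiv_apply_apply d2, hM.conjugate_compatible hx W] at e2
  rw [e2]
  simp only [map_add, add_apply]
  ring

set_option maxSynthPendingDepth 6 in
/-- The curvature of the conjugate connection. -/
theorem conjugate_gauss (hM : IsLocalHypersphere U f ξ H) (hx : x ∈ U) (W X Z : E3) :
    fderiv ℝ (fun y => conjugateConnection f ξ y X Z) x W
        - fderiv ℝ (fun y => conjugateConnection f ξ y W Z) x X
        + conjugateConnection f ξ x W (conjugateConnection f ξ x X Z)
        - conjugateConnection f ξ x X (conjugateConnection f ξ x W Z)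
      = (H * affineMetric f ξ x X Z) • W - (H * affineMetric f ξ x W Z) • X := by
  refine sub_eq_zero.1 ((hM.blaschke x hx).nondegenerate _ fun Y => ?_)
  -- Antisymmetrizing the second derivative of `h` in `W, X` gives `h(R(W,X)Y,Z) + h(Y,R*(W,X)Z) =
  -- 0`, which carries the Gauss equation for the curvature `R` over to the conjugate curvature
  -- `R*`.
  have hsymm : fderiv ℝ (fderiv ℝ (affineMetric f ξ)) x W X
      = fderiv ℝ (fderiv ℝ (affineMetric f ξ)) x X W :=
    (hM.contDiffAt_affineMetric hx).isSymmSndFDerivAt minSmoothness_two_le W X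
  have e1 : fderiv ℝ (fderiv ℝ (affineMetric f ξ)) x W X Y Z
      = fderiv ℝ (fderiv ℝ (affineMetric f ξ)) x X W Y Z := by rw [hsymm]
  rw [hM.second_derivative_affineMetric hx, hM.second_derivative_affineMetric hx] at e1
  have e2 := congrArg (fun V => affineMetric f ξ x V Z) (hM.gauss_codazzi hx X Y W).1
  rw [hM.affineMetric_symm hx _ Y]
  simp only [map_add, map_sub, map_smul, add_apply, sub_apply, smul_apply, smul_eq_mul] at e1 e2 ⊢
  rw [hM.affineMetric_symm hx Y W, hM.affineMetric_symm hx Y X]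
  linarith

theorem riemann_eq (hM : IsLocalHypersphere U f ξ H) (hx : x ∈ U) (W X Z : E3) :
    riemann (affineMetric f ξ) x W X Z
      = (H * affineMetric f ξ x X Z) • W - (H * affineMetric f ξ x W Z) • X
        - (differenceTensor f ξ x W (differenceTensor f ξ x X Z)
          - differenceTensor f ξ x X (differenceTensor f ξ x W Z)) := by
  have d2 := (hM.contDiffAt_inducedConnection hx).differentiableAt (by simp)
  have h1 := hM.conjugate_gauss hx W X Z
  have h2 := (hM.gauss_codazzi hx X Z W).1
  have hfd : ∀ V T : E3, fderiv ℝ (fun y => conjugateConnection f ξ y V Z) x T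
      = (2 : ℝ) • fderiv ℝ (fun y => leviCivita (affineMetric f ξ) y V Z) x T
        - fderiv ℝ (inducedConnection f ξ) x T V Z := by
    intro V T
    unfold conjugateConnection
    have d1 := hM.differentiableAt_leviCivita hx V Z
    have d5 : DifferentiableAt ℝ (fun y => inducedConnection f ξ y V Z) x := by fun_prop
    rw [fderiv_fun_sub (d1.fun_const_smul _) d5, fderiv_fun_const_smul d1,
      ← fderiv_apply_apply d2]
    simp
  have lin : ∀ V A B : E3, leviCivita (affineMetric f ξ) x V (A - B)
      = leviCivita (affineMetric f ξ) x V A - leviCivita (affineMetric f ξ) x V B :=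
    fun V A B => map_sub (leviCivitaLinear (affineMetric f ξ) x V) A B
  have lin2 : ∀ (V A : E3) (c : ℝ), leviCivita (affineMetric f ξ) x V (c • A)
      = c • leviCivita (affineMetric f ξ) x V A :=
    fun V A c => map_smul (leviCivitaLinear (affineMetric f ξ) x V) c A
  rw [hfd, hfd] at h1
  simp only [conjugateConnection, lin, lin2, map_sub, map_smul] at h1
  simp only [riemann, differenceTensor, lin, map_sub]
  -- The derivatives of `K` enter the two curvatures with opposite signs and cancel in the average;
  -- the quadratic terms in `K` remain.
  linear_combination (norm := module) (1 / 2 : ℝ) • h1 + (1 / 2 : ℝ) • h2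

/-! ### Consequences of the symmetry -/

/-- Under a pointwise `ℝ`-symmetry, the difference tensor is a multiple of the cube of an isotropic
covector. -/
theorem exists_isotropic_differenceTensor (hM : IsLocalHypersphere U f ξ H) (hx : x ∈ U)
    (hsym : HasSymmetryAt (Multiplicative ℝ) f ξ x) :
    ∃ (e : E3) (c : ℝ), affineMetric f ξ x e e = 0 ∧ ∀ X Y, differenceTensor f ξ x X Y
      = (c * affineMetric f ξ x e X * affineMetric f ξ x e Y) • e := by
  obtain ⟨C, hC, ⟨φ⟩, hinv⟩ := hsym
  have hs := hM.affineMetric_symm hx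
  have hn := (hM.blaschke x hx).nondegenerate
  obtain ⟨L, hL, hL1, e, he, hee, hLe⟩ := exists_isotropic_fixed hs hn hC φ
  obtain ⟨c, hc⟩ := eq_smul_of_isotropic hs hn (hM.isTracelessCubic hx) hL.1 (hinv L hL).1 hL1
    he hee hLe
  exact ⟨e, c, hee, hc⟩

/-- All values of `K` are multiples of `e`, and `K(·, e) = 0` because `e` is isotropic, so every
product `K(W, K(X, Z))` vanishes. -/
theorem riemann_eq_of_symmetry (hM : IsLocalHypersphere U f ξ H) (hx : x ∈ U)
    (hsym : HasSymmetryAt (Multiplicative ℝ) f ξ x) (W X Z : E3) :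
    riemann (affineMetric f ξ) x W X Z
      = (H * affineMetric f ξ x X Z) • W - (H * affineMetric f ξ x W Z) • X := by
  obtain ⟨e, c, hee, hK⟩ := hM.exists_isotropic_differenceTensor hx hsym
  rw [hM.riemann_eq hx]
  simp [hK, hee]

theorem sectionalCurvature_eq (hM : IsLocalHypersphere U f ξ H) (hx : x ∈ U)
    (hsym : HasSymmetryAt (Multiplicative ℝ) f ξ x) {X Y : E3}
    (hXY : planeForm (affineMetric f ξ) x X Y ≠ 0) :
    sectionalCurvature (affineMetric f ξ) x X Y = H := by
  rw [sectionalCurvature, div_eq_iff hXY, hM.riemann_eq_of_symmetry hx hsym, planeForm]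
  simp only [map_sub, map_smul, sub_apply, smul_apply, smul_eq_mul, hM.affineMetric_symm hx Y X]
  ring

theorem ricci_eq (hM : IsLocalHypersphere U f ξ H) (hx : x ∈ U)
    (hsym : HasSymmetryAt (Multiplicative ℝ) f ξ x) (X Y : E3) :
    ricci (affineMetric f ξ) x X Y = 2 * H * affineMetric f ξ x X Y := by
  have h1 : ∑ i, X i * affineMetric f ξ x (coordVec i) Y = affineMetric f ξ x X Y := by
    conv_rhs => rw [← sum_smul_coordVec X]
    simp
  rw [← h1]
  simp [ricci, hM.riemann_eq_of_symmetry hx hsym, Fin.sum_univ_three, coordVec] at h1 ⊢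
  rw [← h1]
  ring

theorem scalarCurvature_eq (hM : IsLocalHypersphere U f ξ H) (hx : x ∈ U)
    (hsym : HasSymmetryAt (Multiplicative ℝ) f ξ x) :
    scalarCurvature (affineMetric f ξ) x = H := by
  let G : Matrix (Fin 3) (Fin 3) ℝ :=
    Matrix.of fun i j => affineMetric f ξ x (coordVec i) (coordVec j)
  have hG : (G⁻¹ * G).trace = 3 := by
    rw [Matrix.nonsing_inv_mul _ (hM.det_gram_ne_zero hx).isUnit]
    simp
  have h1 : ∑ i, ∑ j, inverseMetric (affineMetric f ξ) x i j
      * affineMetric f ξ x (coordVec i) (coordVec j) = 3 := by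
    rw [← hG]
    simp only [Matrix.trace, Matrix.diag_apply, Matrix.mul_apply]
    refine Finset.sum_congr rfl fun i _ => Finset.sum_congr rfl fun j _ => ?_
    rw [hM.affineMetric_symm hx]
    rfl
  have h2 : ∑ i, ∑ j, inverseMetric (affineMetric f ξ) x i j
      * ricci (affineMetric f ξ) x (coordVec i) (coordVec j) = 2 * H * 3 := by
    rw [← h1]
    simp only [hM.ricci_eq hx hsym, Finset.mul_sum]
    refine Finset.sum_congr rfl fun i _ => Finset.sum_congr rfl fun j _ => ?_
    ring
  rw [scalarCurvature, h2]
  ring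

theorem pickInvariant_eq_zero (hM : IsLocalHypersphere U f ξ H) (hx : x ∈ U)
    (hsym : HasSymmetryAt (Multiplicative ℝ) f ξ x) : pickInvariant f ξ x = 0 := by
  obtain ⟨e, c, hee, hK⟩ := hM.exists_isotropic_differenceTensor hx hsym
  simp [pickInvariant, hK, hee]

end IsLocalHypersphere

/-! ### Passage from charts to the manifold -/

theorem IsAffineHypersphere.isLocalHypersphere {M : Type*} [TopologicalSpace M]
    [ChartedSpace E3 M] [IsManifold (𝓡 3) ∞ M] {φ ξ : M → E4} {H : ℝ}
    (hM : IsAffineHypersphere φ ξ H) {e : OpenPartialHomeomorph M E3}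
    (he : e ∈ IsManifold.maximalAtlas (𝓡 3) ∞ M) :
    IsLocalHypersphere e.target (φ ∘ e.symm) (ξ ∘ e.symm) H where
  isOpen := e.open_target
  smooth := (hM.smooth.comp_contMDiffOn (contMDiffOn_symm_of_mem_maximalAtlas he)).contDiffOn
  smooth_normal :=
    (hM.smooth_normal.comp_contMDiffOn (contMDiffOn_symm_of_mem_maximalAtlas he)).contDiffOn
  blaschke x hx := hM.blaschke e he x hx
  shape x hx := hM.shape e he x hx

end AffineGeometry

end

/-- A 3-dimensional indefinite affine hypersphere admitting a pointwise `ℝ`-symmetry has constant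
sectional curvature `H`, normalized scalar curvature `H`, and vanishing Pick invariant. -/
theorem theorem6p1 {M : Type*} [TopologicalSpace M] [ChartedSpace AffineGeometry.E3 M]
    [IsManifold (𝓡 3) ∞ M] (φ ξ : M → AffineGeometry.E4) (H : ℝ)
    (hM : AffineGeometry.IsAffineHypersphere φ ξ H)
    (hind : AffineGeometry.IsIndefinite φ ξ)
    (hsym : AffineGeometry.AdmitsPointwiseSymmetry (Multiplicative ℝ) φ ξ) :
    AffineGeometry.HasConstantSectionalCurvature φ ξ H ∧
    AffineGeometry.Everywhere φ ξ (fun f ξ x =>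
      AffineGeometry.scalarCurvature (AffineGeometry.affineMetric f ξ) x = H) ∧
    AffineGeometry.Everywhere φ ξ (fun f ξ x => AffineGeometry.pickInvariant f ξ x = 0) := by
  refine ⟨fun e he x hx X Y hXY => ?_, fun e he x hx => ?_, fun e he x hx => ?_⟩
  · exact (hM.isLocalHypersphere he).sectionalCurvature_eq hx (hsym e he x hx) hXY
  · exact (hM.isLocalHypersphere he).scalarCurvature_eq hx (hsym e he x hx)
  · exact (hM.isLocalHypersphere he).pickInvariant_eq_zero hx (hsym e he x hx)
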